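/- Let $(I_n,R_n)_{n\in\mathbb Z}$ be an i.i.d. sequence of requests, where $I_n\in\{1,2\}$ is the flow that issues request $n$ and $R_n$ is the requested data item, and put $\nu_k=\mathbb P[I_0=k]$. All data items have size one and belong to one of three disjoint classes $A=\{d^{(A)}_i\}_{i\ge1}$, $B=\{d^{(B)}_i\}_{i\ge1}$, $D=\{d^{(D)}_i\}_{i\ge1}$; let $J_n$ be the class of $R_n$. Flow 1 requests only items of $A$ and $D$, flow 2 only items of $B$ and $D$, with $\mathbb P[J_0=A\mid I_0=1]=p_A^{(1)}$, $\mathbb P[J_0=D\mid I_0=1]=p_D^{(1)}$, $p_A^{(1)}+p_D^{(1)}=1$, $\mathbb P[J_0=B\mid I_0=2]=p_B^{(2)}$, $\mathbb P[J_0=D\mid I_0=2]=p_D^{(2)}$, $p_B^{(2)}+p_D^{(2)}=1$. For a common exponent $\alpha>1$, as $i\to\infty$, $\mathbb P[R_0=d_i^{(A)}\mid I_0=1,J_0=A]\sim c_A/i^\alpha$, $\mathbb P[R_0=d_i^{(B)}\mid I_0=2,J_0=B]\sim c_B/i^\alpha$ and $\mathbb P[R_0=d_i^{(D)}\mid I_0=k,J_0=D]\sim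 c_D/i^\alpha$ for $k=1,2$. All of $P=(\nu_1,\nu_2,c_A,c_B,c_D,p_A^{(1)},p_B^{(2)},p_D^{(1)},p_D^{(2)})$ are strictly positive. Let $\mathbb P_p[C_0>x\mid I_0=k]$ be the stationary LRU miss probability of flow $k$ when one cache of size $x$ serves both flows (pooling), and $\mathbb P_s[C_0>y\mid I_0=k]$ the one when flow $k$ is served alone by an LRU cache of size $y$ (separation); here $C_0$ is the number of items in front of the item $R_0$ in the move-to-front list of the cache that handles the request, just before that request. For $u=(u_1,u_2)$, the good region $\mathcal G_u$ is the set of strictly positive $P$ that satisfy, with $p_D^*=p_D^{(1)}\nu_1+p_D^{(2)}\nu_2$, $$\frac{\left((c_Ap_A^{(1)})^{1/\alpha}+(c_Dp_D^{(1)})^{1/\alpha}\right)^{\alpha}}{\left((c_Ap_A^{(1)}\nu_1)^{1/\alpha}+(c_Bp_B^{(2)}\nu_2)^{1/\alpha}+(c_Dp_D^*)^{1/\alpha}\right)^{\alpha-1}}>u_1^{\alpha-1}\left(\frac{(c_Ap_A^{(1)})^{1/\alpha}}{\nu_1^{1-1/\alpha}}+\frac{c_D^{1/\alpha}p_D^{(1)}}{(p_D^*)^{1-1/\alpha}}\right)$$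 and the symmetric inequality in which the two flows (that is, $u_1,\nu_1,c_A,p_A^{(1)},p_D^{(1)}$ and $u_2,\nu_2,c_B,p_B^{(2)},p_D^{(2)}$) are exchanged. (i) For all $u_1,u_2>0$ (in particular for every separation with positive fractions, $u_1+u_2=1$), if $P\in\mathcal G_u$, then for $k=1,2$ the following limit exists and $$\lim_{x\to\infty}\frac{\mathbb P_p[C_0>x\mid I_0=k]}{\mathbb P_s[C_0>u_kx\mid I_0=k]}<1 .$$ (ii) Call $u^*$ with $u_1^*,u_2^*\ge0$, $u_1^*+u_2^*=1$ an optimal static separation if it minimizes the overall asymptotic miss probability, that is, if for every $v$ with $v_1,v_2\ge0$, $v_1+v_2=1$ the upper limit, as $x\to\infty$, of the ratio of $\sum_k\nu_k\mathbb P_s[C_0>u^*_kx\mid I_0=k]$ to $\sum_k\nu_k\mathbb P_s[C_0>v_kx\mid I_0=k]$ is at most $1$. An optimal static separation exists, and every optimal static separation $u^*$ has positive fractions and satisfies $P\in\mathcal G_{u^*}$. -/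

import Mathlib

open MeasureTheory ProbabilityTheory Filter Topology Asymptotics

noncomputable section

namespace LRUCache

/-- The three disjoint classes of data items: `A` is requested by flow 1 only, `B` by flow 2 only,
and `D` by both flows. -/
inductive ItemClass
  | A
  | B
  | D
  deriving DecidableEq

instance : MeasurableSpace ItemClass := ⊤

instance : DiscreteMeasurableSpace ItemClass := ⟨fun _ => trivial⟩

/-- A data item is a class together with an index inside the class; `(J, i)` is the item
`d^{(J)}_{i+1}`. All data items have size one. -/
abbrev DataItem := ItemClass × ℕ

/-- The parameters of two flows with overlapping data items. -/
structure Params where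
  /-- fraction of the requests that come from flow 1 -/
  ν₁ : ℝ
  /-- fraction of the requests that come from flow 2 -/
  ν₂ : ℝ
  /-- Zipf constant of class `A` -/
  cA : ℝ
  /-- Zipf constant of class `B` -/
  cB : ℝ
  /-- Zipf constant of class `D` -/
  cD : ℝ
  /-- probability that a request of flow 1 is for class `A` -/
  pA₁ : ℝ
  /-- probability that a request of flow 2 is for class `B` -/
  pB₂ : ℝ
  /-- probability that a request of flow 1 is for class `D` -/
  pD₁ : ℝ
  /-- probability that a request of flow 2 is for class `D` -/
  pD₂ : ℝ

/-- All parameters are strictly positive. -/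
def Params.Pos (P : Params) : Prop :=
  0 < P.ν₁ ∧ 0 < P.ν₂ ∧ 0 < P.cA ∧ 0 < P.cB ∧ 0 < P.cD ∧
    0 < P.pA₁ ∧ 0 < P.pB₂ ∧ 0 < P.pD₁ ∧ 0 < P.pD₂

/-- Exchange the roles of the two flows (and of the classes `A` and `B`). -/
def Params.swap (P : Params) : Params where
  ν₁ := P.ν₂
  ν₂ := P.ν₁
  cA := P.cB
  cB := P.cA
  cD := P.cD
  pA₁ := P.pB₂
  pB₂ := P.pA₁
  pD₁ := P.pD₂
  pD₂ := P.pD₁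

/-- The overall probability `p_D^*` of a request for class `D`. -/
def Params.pDstar (P : Params) : ℝ := P.pD₁ * P.ν₁ + P.pD₂ * P.ν₂

/-- The defining inequality of the good region for flow 1, with fraction `u₁` of the cache. -/
def Params.GoodForFlow₁ (P : Params) (α u₁ : ℝ) : Prop :=
  u₁ ^ (α - 1) *
      ((P.cA * P.pA₁) ^ (1 / α) / P.ν₁ ^ (1 - 1 / α) +
        P.cD ^ (1 / α) * P.pD₁ / P.pDstar ^ (1 - 1 / α)) <
    ((P.cA * P.pA₁) ^ (1 / α) + (P.cD * P.pD₁) ^ (1 / α)) ^ α /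
      ((P.cA * P.pA₁ * P.ν₁) ^ (1 / α) + (P.cB * P.pB₂ * P.ν₂) ^ (1 / α) +
        (P.cD * P.pDstar) ^ (1 / α)) ^ (α - 1)

/-- The good region `G_u`. Flow 1 is flow `0 : Fin 2` and flow 2 is flow `1 : Fin 2`. -/
def goodRegion (α : ℝ) (u : Fin 2 → ℝ) : Set Params :=
  {P | P.Pos ∧ P.GoodForFlow₁ α (u 0) ∧ P.swap.GoodForFlow₁ α (u 1)}

/-- The items that are in front of the item requested at time `n`, just before that request, in
the move-to-front list that handles the requests with indices in `served`: those items whose last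
request that was served is more recent than the last served request for the item `R n`. -/
def itemsInFront (served : Set ℤ) (R : ℤ → DataItem) (n : ℤ) : Set DataItem :=
  {d | ∃ m < n, m ∈ served ∧ R m = d ∧ ∀ j, m ≤ j → j < n → j ∈ served → R j ≠ R n}

/-- The search cost `C_n`: the total size of the (unit-size) items in front of the requested one. -/
def searchCost (served : Set ℤ) (R : ℤ → DataItem) (n : ℤ) : ℕ∞ :=
  (itemsInFront served R n).encard

/-- `{C_n > y}`: the request at time `n` is a miss for a cache of size `y`. -/
def IsMiss (served : Set ℤ) (R : ℤ → DataItem) (n : ℤ) (y : ℝ) : Prop :=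
  ENNReal.ofReal y < ((searchCost served R n : ℕ∞) : ENNReal)

variable {Ω : Type*} [MeasurableSpace Ω]

/-- The stationary sequence of requests of two flows: `I n` is the flow that issues request `n` and
`R n` is the item it asks for (whose class is `(R n).1`). -/
structure IsRequestModel (μ : Measure Ω) (I : ℤ → Ω → Fin 2) (R : ℤ → Ω → DataItem)
    (α : ℝ) (P : Params) : Prop where
  measurable_flow : ∀ n, Measurable (I n)
  measurable_item : ∀ n, Measurable (R n)
  indep : iIndepFun (fun n ω => (I n ω, R n ω)) μ
  identDistrib : ∀ n, IdentDistrib (fun ω => (I n ω, R n ω)) (fun ω => (I 0 ω, R 0 ω)) μ μ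
  flow₁ : μ.real {ω | I 0 ω = 0} = P.ν₁
  flow₂ : μ.real {ω | I 0 ω = 1} = P.ν₂
  classA : (μ[|{ω | I 0 ω = 0}]).real {ω | (R 0 ω).1 = ItemClass.A} = P.pA₁
  classD₁ : (μ[|{ω | I 0 ω = 0}]).real {ω | (R 0 ω).1 = ItemClass.D} = P.pD₁
  classB : (μ[|{ω | I 0 ω = 1}]).real {ω | (R 0 ω).1 = ItemClass.B} = P.pB₂
  classD₂ : (μ[|{ω | I 0 ω = 1}]).real {ω | (R 0 ω).1 = ItemClass.D} = P.pD₂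
  sum₁ : P.pA₁ + P.pD₁ = 1
  sum₂ : P.pB₂ + P.pD₂ = 1
  zipfA : (fun i : ℕ => (μ[|{ω | I 0 ω = 0 ∧ (R 0 ω).1 = ItemClass.A}]).real
      {ω | R 0 ω = (ItemClass.A, i)}) ~[atTop] fun i : ℕ => P.cA / ((i : ℝ) + 1) ^ α
  zipfB : (fun i : ℕ => (μ[|{ω | I 0 ω = 1 ∧ (R 0 ω).1 = ItemClass.B}]).real
      {ω | R 0 ω = (ItemClass.B, i)}) ~[atTop] fun i : ℕ => P.cB / ((i : ℝ) + 1) ^ α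
  zipfD : ∀ k : Fin 2, (fun i : ℕ => (μ[|{ω | I 0 ω = k ∧ (R 0 ω).1 = ItemClass.D}]).real
      {ω | R 0 ω = (ItemClass.D, i)}) ~[atTop] fun i : ℕ => P.cD / ((i : ℝ) + 1) ^ α

/-- `ℙ_p[C_0 > y | I_0 = k]`: one cache of size `y` serves the requests of both flows. -/
def poolMiss (μ : Measure Ω) (I : ℤ → Ω → Fin 2) (R : ℤ → Ω → DataItem) (k : Fin 2) (y : ℝ) : ℝ :=
  (μ[|{ω | I 0 ω = k}]).real {ω | IsMiss Set.univ (fun n => R n ω) 0 y}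

/-- `ℙ_s[C_0 > y | I_0 = k]`: flow `k` has a cache of size `y` of its own, which serves the requests
of flow `k` only. -/
def sepMiss (μ : Measure Ω) (I : ℤ → Ω → Fin 2) (R : ℤ → Ω → DataItem) (k : Fin 2) (y : ℝ) : ℝ :=
  (μ[|{ω | I 0 ω = k}]).real {ω | IsMiss {n | I n ω = k} (fun n => R n ω) 0 y}

/-- The overall miss probability when a cache of size `x` is divided into the parts `v k * x`. -/
def overallSepMiss (μ : Measure Ω) (I : ℤ → Ω → Fin 2) (R : ℤ → Ω → DataItem)
    (v : Fin 2 → ℝ) (x : ℝ) : ℝ :=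
  ∑ k, μ.real {ω | I 0 ω = k} * sepMiss μ I R k (v k * x)

/-- A static separation: nonnegative fractions with sum one. -/
def IsSeparation (v : Fin 2 → ℝ) : Prop := (∀ k, 0 ≤ v k) ∧ ∑ k, v k = 1

/-- `u` minimizes the overall asymptotic miss probability among all static separations `v`:
the upper limit of the ratio of the overall miss probabilities for `u` and `v` is at most one. -/
def IsOptimalSeparation (μ : Measure Ω) (I : ℤ → Ω → Fin 2) (R : ℤ → Ω → DataItem)
    (u : Fin 2 → ℝ) : Prop :=
  IsSeparation u ∧ ∀ v, IsSeparation v → ∀ ε > 0, ∀ᶠ x in atTop,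
    overallSepMiss μ I R u x ≤ (1 + ε) * overallSepMiss μ I R v x

end LRUCache

end

/-! Fix a cache serving the flows in a set `K`, and look back over the last n requests of both
flows. If the requested item does not occur among the served ones, every item that does occur lies
in front of it; if it occurs, everything in front occurs there too. So, up to the event that the
number of distinct recent items falls on the wrong side of y, a miss in a cache of size y means that
the item is unseen for n requests (`missProb_le`, `le_missProb`). The exceptional event is
controlled by Chernoff bounds: although occupancies of different items are dependent, the Laplace
transform of their number is at most that of independent indicators (`integral_weight_le`).

With Zipf laws of a common exponent, the expected number of distinct items grows like M n^(1/α), and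
the probability of being unseen decays like L n^(-(1-1/α)); both follow by turning sums over items
into integrals (`tendsto_scaled_tsum`). Choosing n with M n^(1/α) = y/β up to rounding makes the
Chernoff error exponentially small in y for each β ≠ 1, and β → 1 gives y^(α-1) * miss → L M^(α-1)
(`tendsto_of_sandwich`). Classes enter only through powers 1/α of their Zipf constants.

Write w_k for the size coefficient of flow k alone, S for that of the pooled stream and T_k for the
share of flow k in the pooled misses. The limits are then, up to a common factor, w_k^α for
separation and T_k S^(α-1) for pooling. Hence the limiting ratio in (i) is u_k^(α-1) T_k S^(α-1) /
w_k^α, and the good region says exactly that it is below 1 (`mem_goodRegion_iff`). For (ii),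
Jensen's inequality shows that the fractions must be proportional to w (`sum_rpow_le`,
`eq_proportionalSeparation`). Since the shared class makes T_k < w_k and S = ∑ T_k < ∑ w_k, these
fractions satisfy the good inequalities (`proportional_pool_lt`). -/

noncomputable section

namespace LRUCache

/-! ### Exponential moments and tail bounds for the number of distinct labels. -/

section Occupancy

/-- Weierstrass' product inequality for numbers of constant sign. -/
theorem one_add_sum_le_prod_one_add {ι : Type*} (s : Finset ι) (x : ι → ℝ)
    (hx : ∀ i ∈ s, -1 ≤ x i) (hs : (∀ i ∈ s, 0 ≤ x i) ∨ (∀ i ∈ s, x i ≤ 0)) :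
    1 + ∑ i ∈ s, x i ≤ ∏ i ∈ s, (1 + x i) := by
  classical
  induction s using Finset.induction_on with
  | empty => simp
  | insert a s ha ih =>
    rw [Finset.sum_insert ha, Finset.prod_insert ha]
    have ih' := ih (fun i hi => hx i (Finset.mem_insert_of_mem hi))
      (hs.imp (fun h i hi => h i (Finset.mem_insert_of_mem hi))
        (fun h i hi => h i (Finset.mem_insert_of_mem hi)))
    have ha1 := hx a (Finset.mem_insert_self a s)
    have hprod : 0 ≤ x a * (∑ i ∈ s, x i) := by
      rcases hs with h | h
      · exact mul_nonneg (h a (Finset.mem_insert_self a s))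
          (Finset.sum_nonneg fun i hi => h i (Finset.mem_insert_of_mem hi))
      · exact mul_nonneg_of_nonpos_of_nonpos (h a (Finset.mem_insert_self a s))
          (Finset.sum_nonpos fun i hi => h i (Finset.mem_insert_of_mem hi))
    nlinarith [mul_le_mul_of_nonneg_left ih' (by linarith : 0 ≤ 1 + x a)]

variable {E ι : Type*} [DecidableEq ι]

/-- The labels met among the first `n` terms of a sequence. -/
def seen (lbl : E → Option ι) (z : ℕ → E) (n : ℕ) : Finset ι :=
  ((Finset.range n).image fun i => lbl (z i)).eraseNone

theorem mem_seen {lbl : E → Option ι} {z : ℕ → E} {n : ℕ} {d : ι} :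
    d ∈ seen lbl z n ↔ ∃ i < n, lbl (z i) = some d := by
  simp [seen]

/-- The Laplace weight of the number of labels in `F` that were met. -/
def weight (lbl : E → Option ι) (t : ℝ) (n : ℕ) (F : Finset ι) (z : ℕ → E) : ℝ :=
  (1 + t) ^ (F ∩ seen lbl z n).card

/-- If the new term has label `e ∈ F`, then `e` is counted afterwards whether or not it was met
before, so the new weight is `1 + t` times that of `F.erase e`. The correction thus factors into a
function of the new term and one of the earlier terms, which independence separates. -/
theorem weight_succ (lbl : E → Option ι) (t : ℝ) (n : ℕ) (F : Finset ι) (z : ℕ → E) :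
    weight lbl t (n + 1) F z = weight lbl t n F z + ∑ e ∈ F,
      (if lbl (z n) = some e then 1 else 0) *
        ((1 + t) * weight lbl t n (F.erase e) z - weight lbl t n F z) := by
  have hs : ∀ d, d ∈ seen lbl z (n + 1) ↔ d ∈ seen lbl z n ∨ lbl (z n) = some d := by
    intro d
    simp only [mem_seen, Nat.lt_succ_iff_lt_or_eq]
    constructor
    · rintro ⟨i, hi | rfl, h⟩
      · exact Or.inl ⟨i, hi, h⟩
      · exact Or.inr h
    · rintro (⟨i, hi, h⟩ | h)
      · exact ⟨i, Or.inl hi, h⟩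
      · exact ⟨n, Or.inr rfl, h⟩
  by_cases hF : ∃ e ∈ F, lbl (z n) = some e
  · obtain ⟨e, he, hz⟩ := hF
    rw [Finset.sum_eq_single_of_mem e he]
    · rw [if_pos hz, one_mul, add_sub_cancel, weight, weight, ← pow_succ']
      congr 1
      have : F ∩ seen lbl z (n + 1) = insert e (F.erase e ∩ seen lbl z n) := by
        ext d
        simp only [Finset.mem_inter, hs, hz, Finset.mem_insert, Finset.mem_erase,
          Option.some.injEq]
        constructor
        · rintro ⟨h1, h2⟩
          by_cases hd : d = e
          · exact Or.inl hd
          · exact Or.inr ⟨⟨hd, h1⟩, h2.resolve_right fun h => hd h.symm⟩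
        · rintro (rfl | ⟨⟨_, h1⟩, h2⟩)
          · exact ⟨he, Or.inr rfl⟩
          · exact ⟨h1, Or.inl h2⟩
      rw [this, Finset.card_insert_of_notMem (by simp)]
    · intro d _ hd
      rw [if_neg, zero_mul]
      rw [hz]
      simpa using hd.symm
  · push Not at hF
    rw [Finset.sum_eq_zero, add_zero, weight, weight]
    · congr 2
      ext d
      simp only [Finset.mem_inter, hs]
      constructor
      · rintro ⟨h1, h2⟩
        exact ⟨h1, h2.resolve_right (hF d h1)⟩
      · rintro ⟨h1, h2⟩
        exact ⟨h1, Or.inl h2⟩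
    · intro d hd
      rw [if_neg (hF d hd), zero_mul]

/-- A function of the first `n` terms of a sequence of discrete variables factors through a
measurable function. -/
theorem exists_seen_factor (lbl : E → Option ι) {Ω : Type*} (Z : ℕ → Ω → E) (n : ℕ) {γ : Type*}
    (g : Finset ι → γ) :
    ∃ φ : ((i : Finset.range n) → E) → γ,
      ∀ ω, g (seen lbl (fun i => Z i ω) n) = φ (fun i => Z i ω) := by
  refine ⟨fun z => g ((Finset.univ.image fun i => lbl (z i)).eraseNone), fun ω => ?_⟩
  congr 1
  ext d
  simp [seen]

theorem weight_nonneg {lbl : E → Option ι} {t : ℝ} (ht : -1 < t) (n : ℕ) (F : Finset ι) (z : ℕ → E) :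
    0 ≤ weight lbl t n F z := pow_nonneg (by linarith) _

variable [MeasurableSpace E] [Countable E] [MeasurableSingletonClass E]
  {Ω : Type*} [MeasurableSpace Ω] {μ : Measure Ω} [IsProbabilityMeasure μ]
  {Z : ℕ → Ω → E} {lbl : E → Option ι} {q : ι → ℝ}

theorem measurable_seen_comp (hZ : ∀ i, Measurable (Z i)) (n : ℕ) {γ : Type*} [MeasurableSpace γ]
    (g : Finset ι → γ) : Measurable fun ω => g (seen lbl (fun i => Z i ω) n) := by
  obtain ⟨φ, hφ⟩ := exists_seen_factor lbl Z n g
  simp_rw [hφ]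
  exact (Measurable.of_discrete (f := φ)).comp (measurable_pi_lambda _ fun i => hZ i)

theorem measurable_weight (hZ : ∀ i, Measurable (Z i)) (t : ℝ) (n : ℕ) (F : Finset ι) :
    Measurable fun ω => weight lbl t n F (fun i => Z i ω) :=
  measurable_seen_comp hZ n fun s => (1 + t) ^ (F ∩ s).card

theorem integrable_weight (hZ : ∀ i, Measurable (Z i)) {t : ℝ} (ht : -1 < t) (n : ℕ)
    (F : Finset ι) : Integrable (fun ω => weight lbl t n F (fun i => Z i ω)) μ := by
  refine Integrable.of_bound (measurable_weight hZ t n F).aestronglyMeasurable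
    ((max 1 (1 + t)) ^ F.card) (ae_of_all _ fun ω => ?_)
  rw [Real.norm_eq_abs, abs_of_nonneg (weight_nonneg ht n F _)]
  calc weight lbl t n F (fun i => Z i ω)
      ≤ (max 1 (1 + t)) ^ (F ∩ seen lbl (fun i => Z i ω) n).card :=
        pow_le_pow_left₀ (by linarith) (le_max_right _ _) _
    _ ≤ _ := pow_le_pow_right₀ (le_max_left _ _) (Finset.card_le_card Finset.inter_subset_left)

theorem integral_indicator_mul_seen (hZ : ∀ i, Measurable (Z i)) (hind : iIndepFun Z μ)
    (hq : ∀ i d, μ.real {ω | lbl (Z i ω) = some d} = q d) (n : ℕ) (e : ι) (g : Finset ι → ℝ) :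
    ∫ ω, (if lbl (Z n ω) = some e then 1 else 0) * g (seen lbl (fun i => Z i ω) n) ∂μ =
      q e * ∫ ω, g (seen lbl (fun i => Z i ω) n) ∂μ := by
  obtain ⟨φ, hφ⟩ := exists_seen_factor lbl Z n g
  have hI := hind.indepFun_finset {n} (Finset.range n) (by simp) hZ
  have hI' := hI.comp
    (φ := fun z : (({n} : Finset ℕ) → E) =>
      if lbl (z ⟨n, Finset.mem_singleton_self n⟩) = some e then (1 : ℝ) else 0)
    (ψ := φ) Measurable.of_discrete Measurable.of_discrete
  have hm : Measurable fun ω => if lbl (Z n ω) = some e then (1 : ℝ) else 0 :=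
    (Measurable.of_discrete (f := fun z : E => if lbl z = some e then (1 : ℝ) else 0)).comp (hZ n)
  have hset : MeasurableSet {ω | lbl (Z n ω) = some e} :=
    (hZ n) (MeasurableSet.of_discrete (s := {z | lbl z = some e}))
  have h1 : ∫ ω, (if lbl (Z n ω) = some e then (1 : ℝ) else 0) ∂μ = q e := by
    rw [← hq n e, ← integral_indicator_one hset]
    congr 1
    ext ω
    simp [Set.indicator_apply]
  have h2 := hI'.integral_fun_mul_eq_mul_integral hm.aestronglyMeasurable
    ((Measurable.of_discrete (f := φ)).comp
      (measurable_pi_lambda _ fun i => hZ i)).aestronglyMeasurable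
  simp only [Function.comp_apply] at h2
  rw [h1] at h2
  simp_rw [hφ]
  exact h2

theorem integral_weight_succ (hZ : ∀ i, Measurable (Z i)) (hind : iIndepFun Z μ)
    (hq : ∀ i d, μ.real {ω | lbl (Z i ω) = some d} = q d) {t : ℝ} (ht : -1 < t) (n : ℕ)
    (F : Finset ι) :
    ∫ ω, weight lbl t (n + 1) F (fun i => Z i ω) ∂μ =
      ∫ ω, weight lbl t n F (fun i => Z i ω) ∂μ + ∑ e ∈ F, q e *
        ((1 + t) * ∫ ω, weight lbl t n (F.erase e) (fun i => Z i ω) ∂μ -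
          ∫ ω, weight lbl t n F (fun i => Z i ω) ∂μ) := by
  have hW := fun G => integrable_weight (μ := μ) (lbl := lbl) hZ ht n G
  have hint : ∀ e ∈ F, Integrable (fun ω => (if lbl (Z n ω) = some e then (1 : ℝ) else 0) *
      ((1 + t) * weight lbl t n (F.erase e) (fun i => Z i ω) -
        weight lbl t n F (fun i => Z i ω))) μ := by
    intro e _
    refine Integrable.bdd_mul (c := 1) (((hW _).const_mul _).sub (hW _)) ?_ ?_
    · exact ((Measurable.of_discrete (f := fun z : E => if lbl z = some e then (1 : ℝ)
        else 0)).comp (hZ n)).aestronglyMeasurable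
    · refine ae_of_all _ fun ω => ?_
      split_ifs <;> simp
  simp_rw [weight_succ]
  rw [integral_add (hW F) (integrable_finsetSum _ hint), integral_finsetSum _ hint]
  congr 1
  refine Finset.sum_congr rfl fun e _ => ?_
  rw [← integral_const_mul, ← integral_sub ((hW _).const_mul _) (hW _)]
  exact integral_indicator_mul_seen hZ hind hq n e
    fun s => (1 + t) * (1 + t) ^ (F.erase e ∩ s).card - (1 + t) ^ (F ∩ s).card

theorem sum_label_prob_le_one (hZ : ∀ i, Measurable (Z i))
    (hq : ∀ i d, μ.real {ω | lbl (Z i ω) = some d} = q d) (F : Finset ι) :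
    ∑ e ∈ F, q e ≤ 1 := by
  have hset : ∀ e, MeasurableSet {ω | lbl (Z 0 ω) = some e} := fun e =>
    (hZ 0) (MeasurableSet.of_discrete (s := {z | lbl z = some e}))
  simp_rw [← hq 0]
  rw [← measureReal_biUnion_finset _ fun e _ => hset e]
  · exact measureReal_le_one
  · intro a _ b _ hab
    refine Set.disjoint_left.2 fun ω h1 h2 => hab ?_
    simp only [Set.mem_ofPred_eq] at h1 h2
    simpa using h1.symm.trans h2

/-- The right side is what independent occupancy indicators would give. The bound holds for both
signs of `t`, so it serves both tails. Induction on `n` for all `F` at once: the recursion has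
nonnegative coefficients, so the bounds for `F` and `F.erase e` can be inserted, and Weierstrass'
inequality turns the resulting sum into the product for `n + 1`. -/
theorem integral_weight_le (hZ : ∀ i, Measurable (Z i)) (hind : iIndepFun Z μ)
    (hq : ∀ i d, μ.real {ω | lbl (Z i ω) = some d} = q d) {t : ℝ} (ht : -1 < t) (n : ℕ)
    (F : Finset ι) :
    ∫ ω, weight lbl t n F (fun i => Z i ω) ∂μ ≤ ∏ d ∈ F, (1 + t * (1 - (1 - q d) ^ n)) := by
  have hq0 : ∀ d, 0 ≤ q d := fun d => hq 0 d ▸ measureReal_nonneg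
  have hq1 : ∀ d, q d ≤ 1 := fun d => hq 0 d ▸ measureReal_le_one
  induction n generalizing F with
  | zero => simp [weight, seen]
  | succ n ih =>
    set f : ι → ℝ := fun d => 1 + t * (1 - (1 - q d) ^ n) with hf
    have hp0 : ∀ d, 0 ≤ (1 - q d) ^ n := fun d => pow_nonneg (by linarith [hq1 d]) n
    have hp1 : ∀ d, (1 - q d) ^ n ≤ 1 := fun d =>
      pow_le_one₀ (by linarith [hq1 d]) (by linarith [hq0 d])
    have hfpos : ∀ d, 0 < f d := by
      intro d
      have h1 := hp0 d
      have h2 := hp1 d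
      rcases le_total 0 t with h | h
      · have := mul_nonneg h (sub_nonneg.2 h2)
        simp only [hf]; linarith
      · simp only [hf]; nlinarith
    have herase : ∀ e ∈ F, ∏ d ∈ F.erase e, f d = (∏ d ∈ F, f d) / f e := by
      intro e he
      rw [eq_div_iff (hfpos e).ne', mul_comm, Finset.mul_prod_erase F f he]
    rw [integral_weight_succ hZ hind hq ht]
    calc ∫ ω, weight lbl t n F (fun i => Z i ω) ∂μ + ∑ e ∈ F, q e *
        ((1 + t) * ∫ ω, weight lbl t n (F.erase e) (fun i => Z i ω) ∂μ -
          ∫ ω, weight lbl t n F (fun i => Z i ω) ∂μ)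
        = (1 - ∑ e ∈ F, q e) * ∫ ω, weight lbl t n F (fun i => Z i ω) ∂μ +
          ∑ e ∈ F, q e * ((1 + t) * ∫ ω, weight lbl t n (F.erase e) (fun i => Z i ω) ∂μ) := by
          simp_rw [mul_sub, Finset.sum_sub_distrib, ← Finset.sum_mul]; ring
      _ ≤ (1 - ∑ e ∈ F, q e) * ∏ d ∈ F, f d +
          ∑ e ∈ F, q e * ((1 + t) * ((∏ d ∈ F, f d) / f e)) := by
          refine add_le_add (mul_le_mul_of_nonneg_left (ih F)
            (sub_nonneg.2 (sum_label_prob_le_one hZ hq F))) (Finset.sum_le_sum fun e he => ?_)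
          rw [← herase e he]
          exact mul_le_mul_of_nonneg_left
            (mul_le_mul_of_nonneg_left (ih _) (by linarith)) (hq0 e)
      -- This uses `1 + t - f e = t * (1 - q e) ^ n`.
      _ = (∏ d ∈ F, f d) * (1 + ∑ e ∈ F, t * q e * (1 - q e) ^ n / f e) := by
          rw [mul_add, Finset.mul_sum, sub_mul, Finset.sum_mul, mul_one, sub_add,
            ← Finset.sum_sub_distrib, sub_eq_add_neg, ← Finset.sum_neg_distrib, one_mul]
          congr 1
          refine Finset.sum_congr rfl fun e _ => ?_
          have := (hfpos e).ne'
          field_simp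
          simp only [hf]
          ring
      -- All increments share the sign of `t`, and none is below -1 because adding one to it gives
      -- the ratio of two consecutive nonnegative factors.
      _ ≤ (∏ d ∈ F, f d) * ∏ e ∈ F, (1 + t * q e * (1 - q e) ^ n / f e) := by
          refine mul_le_mul_of_nonneg_left (one_add_sum_le_prod_one_add F _ ?_ ?_)
            (Finset.prod_nonneg fun d _ => (hfpos d).le)
          · intro e _
            rw [le_div_iff₀ (hfpos e)]
            have h1 := hp0 e
            have h2 := hp1 e
            have h3 : 0 ≤ q e * (1 - q e) ^ n := mul_nonneg (hq0 e) h1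
            have h4 : q e * (1 - q e) ^ n ≤ (1 - q e) ^ n := mul_le_of_le_one_left h1 (hq1 e)
            simp only [hf]
            have h5 : 0 ≤ (1 - (1 - q e) ^ n + q e * (1 - q e) ^ n) := by linarith
            nlinarith
          · rcases le_total 0 t with h | h
            · exact Or.inl fun e _ =>
                div_nonneg (mul_nonneg (mul_nonneg h (hq0 e)) (hp0 e)) (hfpos e).le
            · exact Or.inr fun e _ => div_nonpos_of_nonpos_of_nonneg
                (mul_nonpos_of_nonpos_of_nonneg (mul_nonpos_of_nonpos_of_nonneg h (hq0 e))
                  (hp0 e)) (hfpos e).le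
      _ = ∏ d ∈ F, (1 + t * (1 - (1 - q d) ^ (n + 1))) := by
          rw [← Finset.prod_mul_distrib]
          refine Finset.prod_congr rfl fun e _ => ?_
          have := (hfpos e).ne'
          rw [mul_add, mul_div_cancel₀ _ this]
          simp only [hf]
          ring

theorem integral_weight_le_exp (hZ : ∀ i, Measurable (Z i)) (hind : iIndepFun Z μ)
    (hq : ∀ i d, μ.real {ω | lbl (Z i ω) = some d} = q d) {t : ℝ} (ht : -1 < t) (n : ℕ)
    (F : Finset ι) :
    ∫ ω, weight lbl t n F (fun i => Z i ω) ∂μ ≤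
      Real.exp (t * ∑ d ∈ F, (1 - (1 - q d) ^ n)) := by
  have hq0 : ∀ d, 0 ≤ q d := fun d => hq 0 d ▸ measureReal_nonneg
  have hq1 : ∀ d, q d ≤ 1 := fun d => hq 0 d ▸ measureReal_le_one
  refine (integral_weight_le hZ hind hq ht n F).trans ?_
  rw [Finset.mul_sum, Real.exp_sum]
  refine Finset.prod_le_prod (fun d _ => ?_) fun d _ => ?_
  · have h1 : 0 ≤ (1 - q d) ^ n := pow_nonneg (by linarith [hq1 d]) n
    have h2 : (1 - q d) ^ n ≤ 1 := pow_le_one₀ (by linarith [hq1 d]) (by linarith [hq0 d])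
    nlinarith
  · rw [add_comm]
    exact Real.add_one_le_exp _

/-- Chernoff's bound for the number of distinct labels, in terms of a finite set of labels. -/
theorem measure_weight_ge_le (hZ : ∀ i, Measurable (Z i)) (hind : iIndepFun Z μ)
    (hq : ∀ i d, μ.real {ω | lbl (Z i ω) = some d} = q d) {β : ℝ} (hβ : 0 < β) (n : ℕ)
    (F : Finset ι) (y : ℝ) :
    μ.real {ω | β ^ y ≤ β ^ ((F ∩ seen lbl (fun i => Z i ω) n).card : ℝ)} ≤
      Real.exp ((β - 1) * ∑ d ∈ F, (1 - (1 - q d) ^ n) - y * Real.log β) := by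
  have ht : -1 < β - 1 := by linarith
  -- Markov's inequality with `t = β - 1`. Comparing powers of `β` instead of exponents covers the
  -- upper tail for `β > 1` and the lower tail for `β < 1`.
  have h1 := mul_meas_ge_le_integral_of_nonneg (μ := μ)
    (ae_of_all _ fun ω => weight_nonneg (lbl := lbl) ht n F (fun i => Z i ω))
    (integrable_weight hZ ht n F) (β ^ y)
  have h2 := h1.trans (integral_weight_le_exp hZ hind hq ht n F)
  have hβy : (0 : ℝ) < β ^ y := Real.rpow_pos_of_pos hβ y
  rw [mul_comm, ← le_div_iff₀ hβy, Real.rpow_def_of_pos hβ, ← Real.exp_sub,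
    mul_comm (Real.log β) y] at h2
  refine le_trans (le_of_eq ?_) h2
  simp only [weight, add_sub_cancel, Real.rpow_natCast]
  simp only [Real.rpow_def_of_pos hβ, mul_comm (Real.log β) y]

/-- The finite-set bound is uniform in `F`. The event is covered by an increasing union over `F`,
since `F` may be taken to be the set of labels seen, and continuity from below applies. -/
theorem measure_lt_card_seen_le [Countable ι] (hZ : ∀ i, Measurable (Z i)) (hind : iIndepFun Z μ)
    (hq : ∀ i d, μ.real {ω | lbl (Z i ω) = some d} = q d) {β : ℝ} (hβ : 1 < β) (n : ℕ)
    (hs : Summable fun d => 1 - (1 - q d) ^ n) (y : ℝ) :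
    μ.real {ω | y < (seen lbl (fun i => Z i ω) n).card} ≤
      Real.exp ((β - 1) * ∑' d, (1 - (1 - q d) ^ n) - y * Real.log β) := by
  have hq0 : ∀ d, 0 ≤ q d := fun d => hq 0 d ▸ measureReal_nonneg
  have hq1 : ∀ d, q d ≤ 1 := fun d => hq 0 d ▸ measureReal_le_one
  have hU : {ω | y < (seen lbl (fun i => Z i ω) n).card} ⊆
      ⋃ F : Finset ι, {ω | β ^ y ≤ β ^ ((F ∩ seen lbl (fun i => Z i ω) n).card : ℝ)} := by
    intro ω hω
    refine Set.mem_iUnion.2 ⟨seen lbl (fun i => Z i ω) n, ?_⟩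
    simp only [Finset.inter_self, Set.mem_ofPred_eq] at hω ⊢
    exact Real.rpow_le_rpow_of_exponent_le hβ.le hω.le
  have hmono : Monotone fun F : Finset ι =>
      {ω | β ^ y ≤ β ^ ((F ∩ seen lbl (fun i => Z i ω) n).card : ℝ)} := by
    intro F G hFG ω hω
    refine le_trans hω (Real.rpow_le_rpow_of_exponent_le hβ.le ?_)
    exact_mod_cast Finset.card_le_card (Finset.inter_subset_inter_right hFG)
  rw [measureReal_def]
  refine ENNReal.toReal_le_of_le_ofReal (Real.exp_pos _).le ((measure_mono hU).trans ?_)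
  rw [hmono.directed_le.measure_iUnion]
  refine iSup_le fun F => ?_
  rw [← ofReal_measureReal]
  refine ENNReal.ofReal_le_ofReal
    ((measure_weight_ge_le hZ hind hq (by linarith) n F y).trans (Real.exp_le_exp.2 ?_))
  refine sub_le_sub_right (mul_le_mul_of_nonneg_left (hs.sum_le_tsum F fun d _ => ?_)
    (by linarith)) _
  exact sub_nonneg.2 (pow_le_one₀ (by linarith [hq1 d]) (by linarith [hq0 d]))

/-- Restricting to `F` only lowers the count, so the event lies in the finite-set event for every
`F`; the limit is taken on the right side alone. -/
theorem measure_card_seen_le_le (hZ : ∀ i, Measurable (Z i)) (hind : iIndepFun Z μ)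
    (hq : ∀ i d, μ.real {ω | lbl (Z i ω) = some d} = q d) {β : ℝ} (hβ : 0 < β) (hβ1 : β < 1)
    (n : ℕ) (hs : Summable fun d => 1 - (1 - q d) ^ n) (y : ℝ) :
    μ.real {ω | ((seen lbl (fun i => Z i ω) n).card : ℝ) ≤ y} ≤
      Real.exp ((β - 1) * ∑' d, (1 - (1 - q d) ^ n) - y * Real.log β) := by
  have hlim : Tendsto (fun F : Finset ι =>
      Real.exp ((β - 1) * ∑ d ∈ F, (1 - (1 - q d) ^ n) - y * Real.log β)) atTop
      (𝓝 (Real.exp ((β - 1) * ∑' d, (1 - (1 - q d) ^ n) - y * Real.log β))) :=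
    (Real.continuous_exp.tendsto _).comp ((hs.hasSum.const_mul _).sub_const _)
  refine ge_of_tendsto' hlim fun F => ?_
  refine le_trans (measureReal_mono fun ω hω => ?_) (measure_weight_ge_le hZ hind hq hβ n F y)
  refine Real.rpow_le_rpow_of_exponent_ge hβ hβ1.le (le_trans ?_ hω)
  exact_mod_cast Finset.card_le_card Finset.inter_subset_right

end Occupancy

/-! ### Scaling limits of sums over Zipf-distributed items. -/

section ScaledSums

theorem integral_floor_eq_tsum (g : ℕ → ℝ)
    (hg : IntegrableOn (fun x : ℝ => g ⌊x⌋₊) (Set.Ioi 0)) :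
    ∫ x in Set.Ioi (0 : ℝ), g ⌊x⌋₊ = ∑' i, g i := by
  have hU : (⋃ n : ℕ, Set.Ico (n : ℝ) (n + 1)) = Set.Ici 0 := by
    ext x
    simp only [Set.mem_iUnion, Set.mem_Ico, Set.mem_Ici]
    constructor
    · rintro ⟨n, h, _⟩
      exact n.cast_nonneg.trans h
    · intro h
      exact ⟨⌊x⌋₊, Nat.floor_le h, Nat.lt_floor_add_one x⟩
  have hd : Pairwise (Function.onFun Disjoint fun n : ℕ => Set.Ico (n : ℝ) (n + 1)) := by
    intro m n hmn
    refine Set.disjoint_left.2 fun x hm hn => hmn ?_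
    have h1 := (Nat.floor_eq_iff (m.cast_nonneg.trans hm.1)).2 hm
    have h2 := (Nat.floor_eq_iff (n.cast_nonneg.trans hn.1)).2 hn
    exact h1.symm.trans h2
  have hs := hasSum_integral_iUnion (μ := volume) (fun n => measurableSet_Ico) hd
    (f := fun x : ℝ => g ⌊x⌋₊) (by rw [hU, integrableOn_Ici_iff_integrableOn_Ioi]; exact hg)
  rw [hU, integral_Ici_eq_integral_Ioi] at hs
  rw [← hs.tsum_eq]
  refine tsum_congr fun n => ?_
  have : ∫ x in Set.Ico (n : ℝ) (n + 1), g ⌊x⌋₊ = ∫ _ in Set.Ico (n : ℝ) (n + 1), g n := by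
    refine setIntegral_congr_fun measurableSet_Ico fun x hx => ?_
    simp only [(Nat.floor_eq_iff (n.cast_nonneg.trans hx.1)).2 hx]
  rw [this]
  simp

/-- The envelope `min 1 (C x ^ (-α))`, up to a constant. -/
def zipfEnvelope (α C x : ℝ) : ℝ := if x ≤ 1 then 1 else C * x ^ (-α)

theorem integrableOn_zipfEnvelope {α : ℝ} (hα : 1 < α) (C : ℝ) :
    IntegrableOn (zipfEnvelope α C) (Set.Ioi 0) := by
  rw [← Set.Ioc_union_Ioi_eq_Ioi (zero_le_one' ℝ)]
  refine IntegrableOn.union ?_ ?_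
  · refine (integrableOn_const (C := (1 : ℝ)) (by simp) (by simp)).congr_fun (fun x hx => ?_)
      measurableSet_Ioc
    simp [zipfEnvelope, hx.2]
  · refine IntegrableOn.congr_fun (((integrableOn_Ioi_rpow_of_lt
      (by linarith : -α < -1) one_pos)).const_mul C) (fun x hx => ?_) measurableSet_Ioi
    simp [zipfEnvelope, not_le.2 (Set.mem_Ioi.1 hx)]

theorem le_zipfEnvelope {α C x v : ℝ} (h1 : v ≤ 1) (h2 : v ≤ C * x ^ (-α)) :
    v ≤ zipfEnvelope α C x := by
  unfold zipfEnvelope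
  split_ifs
  exacts [h1, h2]

theorem summable_zipf {α : ℝ} (hα : 1 < α) (C : ℝ) :
    Summable fun i : ℕ => C / ((i : ℝ) + 1) ^ α := by
  have h := ((Real.summable_one_div_nat_add_rpow 1 α).2 hα).mul_left C
  refine h.congr fun i => ?_
  rw [abs_of_nonneg (by positivity), mul_one_div]

/-- The sum is the integral of a step function; rescaling by n^(1/α), the order of the largest index
that matters, makes dominated convergence applicable. Since ⌊z⌋ + 1 > z, the bound C n/(i+1)^α
becomes C x^(-α), independent of n. -/
theorem tendsto_scaled_tsum {α C : ℝ} (hα : 1 < α) (hC : 0 ≤ C) {F : ℕ → ℕ → ℝ} {φ : ℝ → ℝ}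
    (h0 : ∀ n i, 0 ≤ F n i) (h1 : ∀ n i, F n i ≤ 1)
    (h2 : ∀ n i, F n i ≤ C * (n / ((i : ℝ) + 1) ^ α))
    (hφ : ∀ x : ℝ, 0 < x →
      Tendsto (fun n : ℕ => F n ⌊x * (n : ℝ) ^ (1 / α)⌋₊) atTop (𝓝 (φ x))) :
    Tendsto (fun n : ℕ => (∑' i, F n i) / (n : ℝ) ^ (1 / α)) atTop
      (𝓝 (∫ x in Set.Ioi (0 : ℝ), φ x)) := by
  have hα0 : 0 < α := by linarith
  have hmeas : ∀ (n : ℕ) (N : ℝ), Measurable fun x : ℝ => F n ⌊x * N⌋₊ := fun n N =>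
    (Measurable.of_discrete (f := F n)).comp
      (Nat.measurable_floor.comp (measurable_id.mul_const N))
  have hbound : ∀ (n : ℕ), 0 < n → ∀ x : ℝ, 0 < x →
      F n ⌊x * (n : ℝ) ^ (1 / α)⌋₊ ≤ zipfEnvelope α C x := by
    intro n hn x hx
    refine le_zipfEnvelope (h1 _ _) ((h2 _ _).trans (mul_le_mul_of_nonneg_left ?_ hC))
    have hn' : (0 : ℝ) < n := by exact_mod_cast hn
    have hN : 0 < x * (n : ℝ) ^ (1 / α) := by positivity
    have h3 : (x * (n : ℝ) ^ (1 / α)) ^ α ≤ ((⌊x * (n : ℝ) ^ (1 / α)⌋₊ : ℝ) + 1) ^ α :=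
      Real.rpow_le_rpow hN.le (Nat.lt_floor_add_one _).le hα0.le
    rw [Real.mul_rpow hx.le (by positivity), ← Real.rpow_mul hn'.le, one_div,
      inv_mul_cancel₀ hα0.ne', Real.rpow_one] at h3
    rw [Real.rpow_neg hx.le, div_le_iff₀ (by positivity), inv_mul_eq_div,
      le_div_iff₀ (by positivity), mul_comm]
    simpa only [one_div] using h3
  have hint : Tendsto (fun n : ℕ => ∫ x in Set.Ioi (0 : ℝ), F n ⌊x * (n : ℝ) ^ (1 / α)⌋₊) atTop
      (𝓝 (∫ x in Set.Ioi (0 : ℝ), φ x)) := by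
    refine tendsto_integral_filter_of_dominated_convergence (zipfEnvelope α C)
      (Eventually.of_forall fun n => (hmeas n _).aestronglyMeasurable) ?_
      (integrableOn_zipfEnvelope hα C) ?_
    · filter_upwards [eventually_gt_atTop 0] with n hn
      refine (ae_restrict_iff' measurableSet_Ioi).2 (ae_of_all _ fun x hx => ?_)
      rw [Real.norm_eq_abs, abs_of_nonneg (h0 _ _)]
      exact hbound n hn x hx
    · exact (ae_restrict_iff' measurableSet_Ioi).2 (ae_of_all _ fun x hx => hφ x hx)
  refine hint.congr' ?_
  filter_upwards [eventually_gt_atTop 0] with n hn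
  have hn' : (0 : ℝ) < n := by exact_mod_cast hn
  have hN : 0 < (n : ℝ) ^ (1 / α) := by positivity
  have hi : IntegrableOn (fun x : ℝ => F n ⌊x⌋₊) (Set.Ioi 0) := by
    refine Integrable.mono' (integrableOn_zipfEnvelope hα (C * n))
      (by simpa using (hmeas n 1).aestronglyMeasurable)
      ((ae_restrict_iff' measurableSet_Ioi).2 (ae_of_all _ fun x hx => ?_))
    rw [Real.norm_eq_abs, abs_of_nonneg (h0 _ _)]
    have hx' : 0 < x := hx
    refine le_zipfEnvelope (h1 _ _) ((h2 _ _).trans ?_)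
    rw [mul_assoc, Real.rpow_neg hx'.le, div_eq_mul_inv]
    gcongr
    exact (Nat.lt_floor_add_one x).le
  rw [integral_comp_mul_right_Ioi (fun x => F n ⌊x⌋₊) 0 hN, zero_mul,
    integral_floor_eq_tsum _ hi, smul_eq_mul, inv_mul_eq_div]

/-- The integral `∫ g (x ^ (-α)) dx` over the positive half line. -/
def zipfIntegral (α : ℝ) (g : ℝ → ℝ) : ℝ := ∫ x in Set.Ioi (0 : ℝ), g (x ^ (-α))

/-- Here b x^(-α) = (b^(-1/α) x)^(-α), so a change of variable pulls the Zipf constant out. This is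
the source of the powers 1/α in all coefficients. -/
theorem integral_zipf_scale {α : ℝ} (hα : 1 < α) {b : ℝ} (hb : 0 < b) (g : ℝ → ℝ) :
    ∫ x in Set.Ioi (0 : ℝ), g (b * x ^ (-α)) = b ^ (1 / α) * zipfIntegral α g := by
  have hα0 : 0 < α := by linarith
  have hc : 0 < b ^ (-(1 / α)) := by positivity
  have h := integral_comp_mul_left_Ioi (fun x : ℝ => g (x ^ (-α))) 0 hc
  rw [mul_zero, smul_eq_mul, Real.rpow_neg hb.le, inv_inv] at h
  rw [zipfIntegral, ← h]
  refine setIntegral_congr_fun measurableSet_Ioi fun x hx => ?_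
  have hx' : 0 < x := hx
  rw [Real.mul_rpow (by positivity) hx'.le, ← Real.rpow_neg hb.le, ← Real.rpow_mul hb.le]
  congr 2
  rw [show -(1 / α) * -α = 1 by field_simp, Real.rpow_one]

/-- The two upper bounds give integrability; without it the integral would be zero by convention. -/
theorem zipfIntegral_pos {α : ℝ} (hα : 1 < α) {g : ℝ → ℝ} (hg : Continuous g)
    (h0 : ∀ s, 0 < s → 0 < g s) (h1 : ∀ s, 0 < s → g s ≤ 1) (h2 : ∀ s, 0 < s → g s ≤ s) :
    0 < zipfIntegral α g := by
  have hpos : ∀ x ∈ Set.Ioi (0 : ℝ), 0 < g (x ^ (-α)) := fun x hx =>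
    h0 _ (Real.rpow_pos_of_pos hx _)
  rw [zipfIntegral, setIntegral_pos_iff_support_of_nonneg_ae]
  · refine lt_of_lt_of_le ?_ (measure_mono
      (fun x (hx : x ∈ Set.Ioi (0 : ℝ)) => ⟨(hpos x hx).ne', hx⟩))
    simp
  · exact (ae_restrict_iff' measurableSet_Ioi).2 (ae_of_all _ fun x hx => (hpos x hx).le)
  · refine Integrable.mono' (integrableOn_zipfEnvelope hα 1) ?_
      ((ae_restrict_iff' measurableSet_Ioi).2 (ae_of_all _ fun x hx => ?_))
    · exact (hg.measurable.comp (measurable_id.pow_const _)).aestronglyMeasurable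
    · rw [Real.norm_eq_abs, abs_of_pos (hpos x hx)]
      exact le_zipfEnvelope (h1 _ (Real.rpow_pos_of_pos hx _))
        ((h2 _ (Real.rpow_pos_of_pos hx _)).trans_eq (one_mul _).symm)

/-- The constant of the expected number of distinct items. -/
def distinctConst (α : ℝ) : ℝ := zipfIntegral α fun s => 1 - Real.exp (-s)

/-- The constant of the miss probability. -/
def missConst (α : ℝ) : ℝ := zipfIntegral α fun s => s * Real.exp (-s)

theorem distinctConst_pos {α : ℝ} (hα : 1 < α) : 0 < distinctConst α := by
  refine zipfIntegral_pos hα (by fun_prop) (fun s hs => ?_) (fun s _ => ?_) fun s _ => ?_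
  · simpa using hs
  · linarith [Real.exp_pos (-s)]
  · linarith [Real.add_one_le_exp (-s)]

theorem mul_exp_neg_le_one (s : ℝ) : s * Real.exp (-s) ≤ 1 :=
  (Real.mul_exp_neg_le_exp_neg_one s).trans (Real.exp_le_one_iff.2 (by norm_num))

theorem missConst_pos {α : ℝ} (hα : 1 < α) : 0 < missConst α := by
  refine zipfIntegral_pos hα (by fun_prop) (fun s hs => ?_) (fun s _ => mul_exp_neg_le_one s)
    fun s hs => ?_
  · positivity
  · exact mul_le_of_le_one_right hs.le (Real.exp_le_one_iff.2 (by linarith))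

section Sequence

variable {α : ℝ} {q r : ℕ → ℝ} {a b : ℝ}

theorem exists_zipf_bound (hq : Tendsto (fun i : ℕ => q i * ((i : ℝ) + 1) ^ α) atTop (𝓝 b)) :
    ∃ C, 0 ≤ C ∧ ∀ i : ℕ, q i ≤ C / ((i : ℝ) + 1) ^ α := by
  obtain ⟨C, hC⟩ := hq.bddAbove_range
  refine ⟨max C 0, le_max_right _ _, fun i => ?_⟩
  rw [le_div_iff₀ (by positivity)]
  exact (hC ⟨i, rfl⟩).trans (le_max_left _ _)

theorem tendsto_mul_at_scaled_index (hα : 1 < α)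
    (hq : Tendsto (fun i : ℕ => q i * ((i : ℝ) + 1) ^ α) atTop (𝓝 b)) {x : ℝ} (hx : 0 < x) :
    Tendsto (fun n : ℕ => (n : ℝ) * q ⌊x * (n : ℝ) ^ (1 / α)⌋₊) atTop (𝓝 (b * x ^ (-α))) := by
  have hα0 : 0 < α := by linarith
  have hN : Tendsto (fun n : ℕ => (n : ℝ) ^ (1 / α)) atTop atTop :=
    (tendsto_rpow_atTop (by positivity)).comp tendsto_natCast_atTop_atTop
  have hi : Tendsto (fun n : ℕ => ⌊x * (n : ℝ) ^ (1 / α)⌋₊) atTop atTop :=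
    tendsto_nat_floor_atTop.comp (hN.const_mul_atTop hx)
  have h1 := hq.comp hi
  have h2 : Tendsto (fun n : ℕ => ((⌊x * (n : ℝ) ^ (1 / α)⌋₊ : ℝ) + 1) / (n : ℝ) ^ (1 / α)) atTop
      (𝓝 x) := by
    have := ((tendsto_nat_floor_mul_div_atTop hx.le).comp hN).add (tendsto_inv_atTop_zero.comp hN)
    rw [add_zero] at this
    refine this.congr fun n => ?_
    simp only [Function.comp_apply, add_div, one_div]
  have h3 := h2.rpow_const (p := -α) (Or.inl hx.ne')
  refine (h1.mul h3).congr' ?_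
  filter_upwards [eventually_gt_atTop 0] with n hn
  have hn' : (0 : ℝ) < n := by exact_mod_cast hn
  simp only [Function.comp_apply]
  have hp : (0 : ℝ) < (⌊x * (n : ℝ) ^ (1 / α)⌋₊ : ℝ) + 1 := by positivity
  rw [Real.div_rpow hp.le (by positivity), ← Real.rpow_mul hn'.le,
    show 1 / α * -α = -1 by field_simp, Real.rpow_neg hp.le, Real.rpow_neg_one]
  have := (Real.rpow_pos_of_pos hp α).ne'
  field_simp

theorem one_sub_one_sub_pow_le {p : ℝ} (h1 : p ≤ 1) (n : ℕ) : 1 - (1 - p) ^ n ≤ n * p := by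
  have := one_add_mul_le_pow (by linarith : (-2 : ℝ) ≤ -p) n
  rw [← sub_eq_add_neg] at this
  linarith

theorem limit_nonneg (hq0 : ∀ i, 0 ≤ q i)
    (hq : Tendsto (fun i : ℕ => q i * ((i : ℝ) + 1) ^ α) atTop (𝓝 b)) : 0 ≤ b :=
  ge_of_tendsto' hq fun i => mul_nonneg (hq0 i) (by positivity)

theorem tendsto_one_sub_pow_at_scaled_index (hα : 1 < α)
    (hq : Tendsto (fun i : ℕ => q i * ((i : ℝ) + 1) ^ α) atTop (𝓝 b)) {x : ℝ} (hx : 0 < x) :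
    Tendsto (fun n : ℕ => (1 - q ⌊x * (n : ℝ) ^ (1 / α)⌋₊) ^ n) atTop
      (𝓝 (Real.exp (-(b * x ^ (-α))))) := by
  have h := Real.tendsto_one_add_pow_exp_of_tendsto (g := fun n => -q ⌊x * (n : ℝ) ^ (1 / α)⌋₊)
    ((tendsto_mul_at_scaled_index hα hq hx).neg.congr fun n => by ring)
  simpa only [← sub_eq_add_neg] using h

theorem summable_distinct (hα : 1 < α) (hq0 : ∀ i, 0 ≤ q i) (hq1 : ∀ i, q i ≤ 1)
    (hq : Tendsto (fun i : ℕ => q i * ((i : ℝ) + 1) ^ α) atTop (𝓝 b)) (n : ℕ) :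
    Summable fun i => 1 - (1 - q i) ^ n := by
  obtain ⟨C, hC0, hC⟩ := exists_zipf_bound hq
  refine Summable.of_nonneg_of_le (fun i => ?_) (fun i => ?_) ((summable_zipf hα C).mul_left (n : ℝ))
  · exact sub_nonneg.2 (pow_le_one₀ (by linarith [hq1 i]) (by linarith [hq0 i]))
  · exact (one_sub_one_sub_pow_le (hq1 i) n).trans
      (mul_le_mul_of_nonneg_left (hC i) n.cast_nonneg)

/-- The expected number of distinct items of one class among `n` requests. -/
theorem tendsto_distinct (hα : 1 < α) (hq0 : ∀ i, 0 ≤ q i) (hq1 : ∀ i, q i ≤ 1)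
    (hq : Tendsto (fun i : ℕ => q i * ((i : ℝ) + 1) ^ α) atTop (𝓝 b)) :
    Tendsto (fun n : ℕ => (∑' i, (1 - (1 - q i) ^ n)) / (n : ℝ) ^ (1 / α)) atTop
      (𝓝 (b ^ (1 / α) * distinctConst α)) := by
  obtain ⟨C, hC0, hC⟩ := exists_zipf_bound hq
  have h := tendsto_scaled_tsum hα hC0 (F := fun n i => 1 - (1 - q i) ^ n)
    (φ := fun x => 1 - Real.exp (-(b * x ^ (-α))))
    (fun n i => sub_nonneg.2 (pow_le_one₀ (by linarith [hq1 i]) (by linarith [hq0 i])))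
    (fun n i => sub_le_self _ (pow_nonneg (by linarith [hq1 i]) n))
    (fun n i => (one_sub_one_sub_pow_le (hq1 i) n).trans ?_)
    (fun x hx => (tendsto_one_sub_pow_at_scaled_index hα hq hx).const_sub 1)
  · convert h using 2
    -- The constant vanishes for a class that the served flows never request; both sides are then 0.
    rcases (limit_nonneg hq0 hq).eq_or_lt with rfl | hb
    · simp [Real.zero_rpow (inv_ne_zero (by linarith : α ≠ 0))]
    · exact (integral_zipf_scale hα hb fun s => 1 - Real.exp (-s)).symm
  · refine (mul_le_mul_of_nonneg_left (hC i) n.cast_nonneg).trans (le_of_eq ?_)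
    ring

/-- The probability that a requested item of one class was not requested `n` times in a row. -/
theorem tendsto_unseen (hα : 1 < α) (hr0 : ∀ i, 0 ≤ r i) (hrq : ∀ i, r i ≤ q i)
    (hq1 : ∀ i, q i ≤ 1) (hr : Tendsto (fun i : ℕ => r i * ((i : ℝ) + 1) ^ α) atTop (𝓝 a))
    (hq : Tendsto (fun i : ℕ => q i * ((i : ℝ) + 1) ^ α) atTop (𝓝 b)) :
    Tendsto (fun n : ℕ => (n : ℝ) * (∑' i, r i * (1 - q i) ^ n) / (n : ℝ) ^ (1 / α)) atTop
      (𝓝 (a / b * b ^ (1 / α) * missConst α)) := by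
  obtain ⟨C, hC0, hC⟩ := exists_zipf_bound hr
  have hq0 : ∀ i, 0 ≤ q i := fun i => (hr0 i).trans (hrq i)
  have h := tendsto_scaled_tsum hα hC0 (F := fun n i => n * (r i * (1 - q i) ^ n))
    (φ := fun x => a * x ^ (-α) * Real.exp (-(b * x ^ (-α))))
    (fun n i => mul_nonneg n.cast_nonneg
      (mul_nonneg (hr0 i) (pow_nonneg (by linarith [hq1 i]) n)))
    (fun n i => ?_) (fun n i => ?_)
    (fun x hx => ((tendsto_mul_at_scaled_index hα hr hx).mul
      (tendsto_one_sub_pow_at_scaled_index hα hq hx)).congr fun n => by ring)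
  · simp_rw [tsum_mul_left] at h
    convert h using 2
    have hab : a ≤ b := le_of_tendsto_of_tendsto' hr hq fun i =>
      mul_le_mul_of_nonneg_right (hrq i) (by positivity)
    rcases (limit_nonneg hq0 hq).eq_or_lt with rfl | hb
    · have : a = 0 := le_antisymm hab (limit_nonneg hr0 hr)
      simp [this]
    · rw [mul_assoc, missConst, ← integral_zipf_scale hα hb fun s => s * Real.exp (-s),
        ← integral_const_mul]
      congr 1
      ext x
      field_simp
  -- The bound by 1 comes from r ≤ q and s e^(-s) ≤ 1 at s = n q.
  · have h1 : (1 - q i) ^ n ≤ Real.exp (-(n * q i)) := by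
      have := pow_le_pow_left₀ (by linarith [hq1 i] : 0 ≤ 1 - q i)
        (by linarith [Real.add_one_le_exp (-q i)] : 1 - q i ≤ Real.exp (-q i)) n
      rwa [← Real.exp_nat_mul, mul_neg] at this
    calc (n : ℝ) * (r i * (1 - q i) ^ n) ≤ n * (q i * Real.exp (-(n * q i))) := by
          refine mul_le_mul_of_nonneg_left (mul_le_mul (hrq i) h1 ?_ (hq0 i)) n.cast_nonneg
          exact pow_nonneg (by linarith [hq1 i]) n
      _ = (n * q i) * Real.exp (-(n * q i)) := by ring
      _ ≤ 1 := mul_exp_neg_le_one _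
  · have h1 : (1 - q i) ^ n ≤ 1 := pow_le_one₀ (by linarith [hq1 i]) (by linarith [hq0 i])
    calc (n : ℝ) * (r i * (1 - q i) ^ n) ≤ n * (C / ((i : ℝ) + 1) ^ α) :=
          mul_le_mul_of_nonneg_left
            ((mul_le_of_le_one_right (hr0 i) h1).trans (hC i)) n.cast_nonneg
      _ = C * (n / ((i : ℝ) + 1) ^ α) := by ring

end Sequence

section Classes

theorem distinct_nonneg {D : Type*} {q : D → ℝ} (hq0 : ∀ d, 0 ≤ q d) (hq1 : ∀ d, q d ≤ 1) (n : ℕ) :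
    0 ≤ fun d => 1 - (1 - q d) ^ n := fun d =>
  sub_nonneg.2 (pow_le_one₀ (by linarith [hq1 d]) (by linarith [hq0 d]))

variable {J : Type*} [Fintype J] {α : ℝ} {q r : J × ℕ → ℝ} {a b : J → ℝ}

theorem tsum_classes {f : J × ℕ → ℝ} (h0 : 0 ≤ f) (h : ∀ j, Summable fun i => f (j, i)) :
    Summable f ∧ ∑' d, f d = ∑ j, ∑' i, f (j, i) := by
  have hs : Summable f := (summable_prod_of_nonneg h0).2 ⟨h, Summable.of_finite⟩
  exact ⟨hs, by rw [hs.tsum_prod, tsum_fintype]⟩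

theorem tendsto_distinct_classes (hα : 1 < α) (hq0 : ∀ d, 0 ≤ q d) (hq1 : ∀ d, q d ≤ 1)
    (hq : ∀ j, Tendsto (fun i : ℕ => q (j, i) * ((i : ℝ) + 1) ^ α) atTop (𝓝 (b j))) :
    Tendsto (fun n : ℕ => (∑' d, (1 - (1 - q d) ^ n)) / (n : ℝ) ^ (1 / α)) atTop
      (𝓝 (distinctConst α * ∑ j, b j ^ (1 / α))) := by
  have h := tendsto_finsetSum (Finset.univ : Finset J) fun j _ =>
    tendsto_distinct hα (fun i => hq0 (j, i)) (fun i => hq1 (j, i)) (hq j)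
  rw [← Finset.sum_mul, mul_comm] at h
  refine h.congr fun n => ?_
  rw [(tsum_classes (distinct_nonneg hq0 hq1 n) fun j => summable_distinct hα
    (fun i => hq0 (j, i)) (fun i => hq1 (j, i)) (hq j) n).2, Finset.sum_div]

theorem tendsto_unseen_classes (hα : 1 < α) (hr0 : ∀ d, 0 ≤ r d) (hrq : ∀ d, r d ≤ q d)
    (hq1 : ∀ d, q d ≤ 1) (hs : Summable r)
    (hr : ∀ j, Tendsto (fun i : ℕ => r (j, i) * ((i : ℝ) + 1) ^ α) atTop (𝓝 (a j)))
    (hq : ∀ j, Tendsto (fun i : ℕ => q (j, i) * ((i : ℝ) + 1) ^ α) atTop (𝓝 (b j))) :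
    Tendsto (fun n : ℕ => (n : ℝ) ^ (1 - 1 / α) * ∑' d, r d * (1 - q d) ^ n) atTop
      (𝓝 (missConst α * ∑ j, a j / b j * b j ^ (1 / α))) := by
  have h := tendsto_finsetSum (Finset.univ : Finset J) fun j _ =>
    tendsto_unseen hα (fun i => hr0 (j, i)) (fun i => hrq (j, i)) (fun i => hq1 (j, i))
      (hr j) (hq j)
  rw [← Finset.sum_mul, mul_comm] at h
  refine h.congr' ?_
  filter_upwards [eventually_gt_atTop 0] with n hn
  have hn' : (0 : ℝ) < n := by exact_mod_cast hn
  have hq0 : ∀ d, 0 ≤ q d := fun d => (hr0 d).trans (hrq d)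
  have hs' : Summable fun d => r d * (1 - q d) ^ n :=
    Summable.of_nonneg_of_le
      (fun d => mul_nonneg (hr0 d) (pow_nonneg (by linarith [hq1 d]) n))
      (fun d => mul_le_of_le_one_right (hr0 d)
        (pow_le_one₀ (by linarith [hq1 d]) (by linarith [hq0 d]))) hs
  have h0' : 0 ≤ fun d => r d * (1 - q d) ^ n := fun d =>
    mul_nonneg (hr0 d) (pow_nonneg (by linarith [hq1 d]) n)
  rw [(tsum_classes h0' fun j => hs'.comp_injective (Prod.mk_right_injective j)).2,
    Real.rpow_sub hn',
    Real.rpow_one, ← Finset.sum_div, ← Finset.mul_sum]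
  ring

end Classes

end ScaledSums

/-! ### From unseen probabilities at a fixed time to miss probabilities at a fixed cache size. -/

section Sandwich

variable {α M L β : ℝ} {m ρ : ℕ → ℝ} {Φ : ℝ → ℝ}

/-- The number of requests that fill the cache of size `y` up to the factor `β`. -/
def fillTime (α M β y : ℝ) : ℕ := ⌊(y / (M * β)) ^ α⌋₊

theorem tendsto_fillTime (hα : 1 < α) (hM : 0 < M) (hβ : 0 < β) :
    Tendsto (fillTime α M β) atTop atTop := by
  refine tendsto_nat_floor_atTop.comp ((tendsto_rpow_atTop (by linarith)).comp ?_)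
  exact tendsto_id.atTop_div_const (by positivity)

theorem tendsto_fillTime_rpow_div (hα : 1 < α) (hM : 0 < M) (hβ : 0 < β) :
    Tendsto (fun y => (fillTime α M β y : ℝ) ^ (1 / α) / y) atTop (𝓝 (M * β)⁻¹) := by
  have hα0 : 0 < α := by linarith
  have hMβ : 0 < M * β := by positivity
  have h1 : Tendsto (fun y : ℝ => (y / (M * β)) ^ α) atTop atTop :=
    (tendsto_rpow_atTop hα0).comp (tendsto_id.atTop_div_const hMβ)
  have h2 := ((tendsto_nat_floor_div_atTop (R := ℝ)).comp h1).rpow_const (p := 1 / α)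
    (Or.inl one_ne_zero)
  have h3 := h2.mul_const (M * β)⁻¹
  rw [Real.one_rpow, one_mul] at h3
  refine h3.congr' ?_
  filter_upwards [eventually_gt_atTop 0] with y hy
  have hy' : 0 < y / (M * β) := by positivity
  simp only [Function.comp_apply]
  rw [Real.div_rpow (Nat.cast_nonneg _) (by positivity), ← Real.rpow_mul hy'.le,
    mul_one_div_cancel hα0.ne', Real.rpow_one, fillTime]
  field_simp

theorem tendsto_mean_fillTime_div (hα : 1 < α) (hM : 0 < M) (hβ : 0 < β)
    (hm : Tendsto (fun n : ℕ => m n / (n : ℝ) ^ (1 / α)) atTop (𝓝 M)) :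
    Tendsto (fun y => m (fillTime α M β y) / y) atTop (𝓝 β⁻¹) := by
  have h := (hm.comp (tendsto_fillTime hα hM hβ)).mul (tendsto_fillTime_rpow_div hα hM hβ)
  rw [mul_inv, mul_inv_cancel_left₀ hM.ne'] at h
  refine h.congr' ?_
  filter_upwards [(tendsto_fillTime hα hM hβ).eventually_gt_atTop 0] with y hy
  have hn : (0 : ℝ) < fillTime α M β y := by exact_mod_cast hy
  have := (Real.rpow_pos_of_pos hn (1 / α)).ne'
  simp only [Function.comp_apply]
  field_simp

theorem tendsto_unseen_fillTime (hα : 1 < α) (hM : 0 < M) (hβ : 0 < β)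
    (hρ : Tendsto (fun n : ℕ => (n : ℝ) ^ (1 - 1 / α) * ρ n) atTop (𝓝 L)) :
    Tendsto (fun y => y ^ (α - 1) * ρ (fillTime α M β y)) atTop
      (𝓝 (L * (M * β) ^ (α - 1))) := by
  have hα0 : 0 < α := by linarith
  have hMβ : 0 < M * β := by positivity
  have h := (hρ.comp (tendsto_fillTime hα hM hβ)).mul
    ((tendsto_fillTime_rpow_div hα hM hβ).rpow_const (p := -(α - 1)) (Or.inl (by positivity)))
  rw [Real.inv_rpow hMβ.le, Real.rpow_neg hMβ.le, inv_inv] at h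
  refine h.congr' ?_
  filter_upwards [(tendsto_fillTime hα hM hβ).eventually_gt_atTop 0,
    eventually_gt_atTop 0] with y hn' hy
  have hn : (0 : ℝ) < fillTime α M β y := by exact_mod_cast hn'
  simp only [Function.comp_apply]
  rw [Real.div_rpow (by positivity) hy.le, ← Real.rpow_mul hn.le,
    show 1 / α * -(α - 1) = -(1 - 1 / α) by field_simp, Real.rpow_neg hn.le, Real.rpow_neg hy.le]
  have := (Real.rpow_pos_of_pos hn (1 - 1 / α)).ne'
  field_simp

/-- At this time the mean is about y/β, for which the tilt `β` minimizes the Chernoff exponent. The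
exponent is asymptotic to y(1 - 1/β - log β), negative by log z < z - 1 at z = 1/β, so the
exponential beats the power of y. -/
theorem tendsto_deviation_fillTime (hα : 1 < α) (hM : 0 < M) (hβ : 0 < β) (hβ1 : β ≠ 1)
    (hm : Tendsto (fun n : ℕ => m n / (n : ℝ) ^ (1 / α)) atTop (𝓝 M)) :
    Tendsto (fun y => y ^ (α - 1) *
      Real.exp ((β - 1) * m (fillTime α M β y) - y * Real.log β)) atTop (𝓝 0) := by
  have hneg : (β - 1) * β⁻¹ - Real.log β < 0 := by
    have h := Real.log_lt_sub_one_of_pos (inv_pos.2 hβ) (by simpa using hβ1)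
    rw [Real.log_inv] at h
    rw [sub_mul, mul_inv_cancel₀ hβ.ne']
    linarith
  obtain ⟨c, hc1, hc2⟩ := exists_between hneg
  have hlim := ((tendsto_mean_fillTime_div hα hM hβ hm).const_mul (β - 1)).sub_const (Real.log β)
  refine squeeze_zero' (g := fun y => y ^ (α - 1) * Real.exp (-(-c) * y)) ?_ ?_
    (tendsto_rpow_mul_exp_neg_mul_atTop_nhds_zero _ _ (by linarith))
  · filter_upwards [eventually_gt_atTop 0] with y hy
    positivity
  · filter_upwards [eventually_gt_atTop 0, hlim.eventually_lt_const hc1] with y hy hlt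
    refine mul_le_mul_of_nonneg_left (Real.exp_le_exp.2 ?_) (by positivity)
    rw [← mul_div_assoc, sub_lt_iff_lt_add, div_lt_iff₀ hy] at hlt
    linarith

/-- A function that is squeezed between the probabilities of being unseen at the times when the
cache is nearly filled inherits their asymptotics. -/
theorem tendsto_of_sandwich (hα : 1 < α) (hM : 0 < M)
    (hm : Tendsto (fun n : ℕ => m n / (n : ℝ) ^ (1 / α)) atTop (𝓝 M))
    (hρ : Tendsto (fun n : ℕ => (n : ℝ) ^ (1 - 1 / α) * ρ n) atTop (𝓝 L))
    (hupper : ∀ β : ℝ, 1 < β → ∀ n : ℕ, ∀ y : ℝ, 0 < y →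
      Φ y ≤ ρ n + Real.exp ((β - 1) * m n - y * Real.log β))
    (hlower : ∀ β : ℝ, 0 < β → β < 1 → ∀ n : ℕ, ∀ y : ℝ, 0 < y →
      ρ n ≤ Φ y + Real.exp ((β - 1) * m n - y * Real.log β)) :
    Tendsto (fun y => y ^ (α - 1) * Φ y) atTop (𝓝 (L * M ^ (α - 1))) := by
  have hcont : ContinuousAt (fun β : ℝ => L * (M * β) ^ (α - 1)) 1 :=
    continuousAt_const.mul ((continuousAt_const.mul continuousAt_id).rpow_const
      (Or.inr (by linarith)))
  have hlim : Tendsto (fun β : ℝ => L * (M * β) ^ (α - 1)) (𝓝 1) (𝓝 (L * M ^ (α - 1))) := by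
    simpa [ContinuousAt] using hcont
  refine tendsto_order.2 ⟨fun c hc => ?_, fun c hc => ?_⟩
  -- For the lower bound `β` is just below 1: the mean number of distinct items then exceeds y, so
  -- an unseen item is almost surely a miss. The upper bound takes `β` just above 1.
  · obtain ⟨β, hβc, hβ0, hβ1⟩ := (((hlim.mono_left nhdsWithin_le_nhds).eventually
      (lt_mem_nhds hc)).and (Ioo_mem_nhdsLT (zero_lt_one' ℝ))).exists
    have h := (tendsto_unseen_fillTime hα hM hβ0 hρ).sub
      (tendsto_deviation_fillTime hα hM hβ0 hβ1.ne hm)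
    rw [sub_zero] at h
    filter_upwards [h.eventually (lt_mem_nhds hβc), eventually_gt_atTop 0] with y hy hy0
    have h2 := mul_le_mul_of_nonneg_left (hlower β hβ0 hβ1 (fillTime α M β y) y hy0)
      (Real.rpow_nonneg hy0.le (α - 1))
    rw [mul_add] at h2
    linarith
  · obtain ⟨β, hβc, hβ1, _⟩ := (((hlim.mono_left nhdsWithin_le_nhds).eventually
      (gt_mem_nhds hc)).and (Ioo_mem_nhdsGT (one_lt_two (α := ℝ)))).exists
    have hβ0 : 0 < β := zero_lt_one.trans hβ1
    have h := (tendsto_unseen_fillTime hα hM hβ0 hρ).add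
      (tendsto_deviation_fillTime hα hM hβ0 hβ1.ne' hm)
    rw [add_zero] at h
    filter_upwards [h.eventually (gt_mem_nhds hβc), eventually_gt_atTop 0] with y hy hy0
    have h2 := mul_le_mul_of_nonneg_left (hupper β hβ1 (fillTime α M β y) y hy0)
      (Real.rpow_nonneg hy0.le (α - 1))
    rw [mul_add] at h2
    linarith

end Sandwich

/-! ### The move-to-front list, its recent past, and the miss asymptotics. -/

section Model

instance : Fintype ItemClass := ⟨{.A, .B, .D}, fun j => by cases j <;> decide⟩

/-- The item of a request when its flow belongs to `K`. -/
def servedLabel (K : Finset (Fin 2)) (e : Fin 2 × DataItem) : Option DataItem :=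
  if e.1 ∈ K then some e.2 else none

theorem servedLabel_eq_some {K : Finset (Fin 2)} {e : Fin 2 × DataItem} {d : DataItem} :
    servedLabel K e = some d ↔ e.1 ∈ K ∧ e.2 = d := by
  unfold servedLabel
  split_ifs with h <;> simp [h]

section Deterministic

variable {K : Finset (Fin 2)} {i : ℤ → Fin 2} {r : ℤ → DataItem} {n : ℕ} {y : ℝ}

/-- The served items among the requests at the times `-1, …, -n`. -/
def recent (K : Finset (Fin 2)) (i : ℤ → Fin 2) (r : ℤ → DataItem) (n : ℕ) : Finset DataItem :=
  seen (servedLabel K) (fun l => (i (-(l + 1)), r (-(l + 1)))) n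

theorem mem_recent {d : DataItem} :
    d ∈ recent K i r n ↔ ∃ j : ℤ, j < 0 ∧ -n ≤ j ∧ i j ∈ K ∧ r j = d := by
  simp only [recent, mem_seen, servedLabel_eq_some]
  constructor
  · rintro ⟨l, hl, h⟩
    exact ⟨-(l + 1), by omega, by omega, h⟩
  · rintro ⟨j, h0, hn, h⟩
    obtain ⟨l, rfl⟩ : ∃ l : ℕ, j = -(l + 1) := ⟨(-j - 1).toNat, by omega⟩
    exact ⟨l, by omega, h⟩

/-- An item in front was last served after the requested one, hence inside any window that contains
a served request for the latter. -/
theorem itemsInFront_subset_recent (h : r 0 ∈ recent K i r n) :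
    itemsInFront {m | i m ∈ K} r 0 ⊆ recent K i r n := by
  rintro d ⟨m, hm, hs, rfl, hj⟩
  obtain ⟨j, hj0, hjn, hjK, hjr⟩ := mem_recent.1 h
  have hlt : j < m := by
    by_contra hcon
    exact hj j (not_lt.1 hcon) hj0 hjK hjr
  exact mem_recent.2 ⟨m, hm, by omega, hs, rfl⟩

/-- No served request in the window is for the requested item, so each served one there puts its
item in front. -/
theorem recent_subset_itemsInFront (h : r 0 ∉ recent K i r n) :
    (recent K i r n : Set DataItem) ⊆ itemsInFront {m | i m ∈ K} r 0 := by
  intro d hd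
  obtain ⟨m, hm0, hmn, hmK, hmr⟩ := mem_recent.1 hd
  refine ⟨m, hm0, hmK, hmr, fun j hj hj0 hjK hjr => h ?_⟩
  exact mem_recent.2 ⟨j, hj0, by omega, hjK, hjr⟩

theorem ofReal_lt_encard_coe (hy : 0 < y) (s : Finset DataItem) :
    ENNReal.ofReal y < (((s : Set DataItem).encard : ℕ∞) : ENNReal) ↔ y < s.card := by
  rw [Set.encard_coe_eq_coe_finsetCard, ENat.toENNReal_coe, ← ENNReal.ofReal_natCast,
    ENNReal.ofReal_lt_ofReal_iff_of_nonneg hy.le]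

theorem lt_card_recent_of_isMiss (hy : 0 < y) (h : IsMiss {m | i m ∈ K} r 0 y)
    (h0 : r 0 ∈ recent K i r n) : y < (recent K i r n).card :=
  (ofReal_lt_encard_coe hy _).1
    (lt_of_lt_of_le h (ENat.toENNReal_le.2 (Set.encard_le_encard (itemsInFront_subset_recent h0))))

theorem isMiss_of_lt_card_recent (hy : 0 < y) (h : y < (recent K i r n).card)
    (h0 : r 0 ∉ recent K i r n) : IsMiss {m | i m ∈ K} r 0 y :=
  lt_of_lt_of_le ((ofReal_lt_encard_coe hy _).2 h)
    (ENat.toENNReal_le.2 (Set.encard_le_encard (recent_subset_itemsInFront h0)))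

end Deterministic

variable {Ω : Type*} [MeasurableSpace Ω] {μ : Measure Ω} [IsProbabilityMeasure μ]
  {I : ℤ → Ω → Fin 2} {R : ℤ → Ω → DataItem} {α : ℝ} {P : Params} {K : Finset (Fin 2)}

/-- The probability that the flow of a request belongs to `K` and its item is `d`. -/
def requestProb (μ : Measure Ω) (I : ℤ → Ω → Fin 2) (R : ℤ → Ω → DataItem) (K : Finset (Fin 2))
    (d : DataItem) : ℝ := μ.real {ω | I 0 ω ∈ K ∧ R 0 ω = d}

/-- The probability that flow `k` issues a request that is a miss for a cache of size `y` serving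
the flows in `K`. -/
def missProb (μ : Measure Ω) (I : ℤ → Ω → Fin 2) (R : ℤ → Ω → DataItem) (K : Finset (Fin 2))
    (k : Fin 2) (y : ℝ) : ℝ :=
  μ.real {ω | I 0 ω = k ∧ IsMiss {n | I n ω ∈ K} (fun n => R n ω) 0 y}

theorem requestProb_nonneg (K : Finset (Fin 2)) (d : DataItem) : 0 ≤ requestProb μ I R K d :=
  measureReal_nonneg

namespace IsRequestModel

variable (h : IsRequestModel μ I R α P)



theorem measurable_request (h : IsRequestModel μ I R α P) (n : ℤ) : Measurable fun ω => (I n ω, R n ω) :=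
  (h.measurable_flow n).prodMk (h.measurable_item n)

theorem measure_request (h : IsRequestModel μ I R α P) (n : ℤ) (S : Set (Fin 2 × DataItem)) :
    μ {ω | (I n ω, R n ω) ∈ S} = μ {ω | (I 0 ω, R 0 ω) ∈ S} :=
  (h.identDistrib n).measure_mem_eq MeasurableSet.of_discrete

theorem servedLabel_prob (h : IsRequestModel μ I R α P) (n : ℤ) (d : DataItem) :
    μ.real {ω | servedLabel K (I n ω, R n ω) = some d} = requestProb μ I R K d := by
  have := h.measure_request n {e | servedLabel K e = some d}
  simp only [Set.mem_ofPred_eq] at this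
  rw [requestProb, measureReal_def, measureReal_def, this]
  simp_rw [servedLabel_eq_some]

theorem iIndepFun_past (h : IsRequestModel μ I R α P) : iIndepFun (fun (l : ℕ) ω => (I (-(l + 1)) ω, R (-(l + 1)) ω)) μ :=
  h.indep.precomp (g := fun l : ℕ => (-(l + 1) : ℤ)) fun a b hab => by
    simp only at hab; omega

/-- The request at time 0 and the `n` before it are independent. Time counts the requests of all
flows, even those that the cache does not serve, so pooling and separation are handled on one clock.
-/
theorem measure_item_unseen (h : IsRequestModel μ I R α P) (k : Fin 2) (d : DataItem) (n : ℕ) :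
    μ.real {ω | (I 0 ω = k ∧ R 0 ω = d) ∧ d ∉ recent K (fun n => I n ω) (fun n => R n ω) n} =
      requestProb μ I R {k} d * (1 - requestProb μ I R K d) ^ n := by
  have hind : iIndepFun (fun (l : ℕ) ω => (I (-l) ω, R (-l) ω)) μ :=
    h.indep.precomp (g := fun l : ℕ => (-l : ℤ)) fun a b hab => by
      simp only at hab; omega
  let S : ℕ → Set (Fin 2 × DataItem) := fun l =>
    if l = 0 then {(k, d)} else {e | servedLabel K e = some d}ᶜ
  have h1 := hind.measure_inter_preimage_eq_mul (Finset.range (n + 1)) (sets := S)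
    (fun _ _ => MeasurableSet.of_discrete)
  have hset : {ω | (I 0 ω = k ∧ R 0 ω = d) ∧
      d ∉ recent K (fun n => I n ω) (fun n => R n ω) n} =
      ⋂ l ∈ Finset.range (n + 1), (fun ω => (I (-(l : ℕ)) ω, R (-(l : ℕ)) ω)) ⁻¹' S l := by
    ext ω
    simp only [Set.mem_ofPred_eq, recent, mem_seen, Set.mem_iInter, Finset.mem_range,
      Set.mem_preimage, not_exists, not_and]
    constructor
    · rintro ⟨h0, h2⟩ l hl
      rcases l with _ | l
      · simp [S, h0]
      · simpa [S] using h2 l (by omega)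
    · intro h2
      refine ⟨by simpa [S] using h2 0 (by omega), fun l hl => ?_⟩
      simpa [S] using h2 (l + 1) (by omega)
  have hl : ∀ l : ℕ, (μ {ω | (I (-((l + 1 : ℕ) : ℤ)) ω, R (-((l + 1 : ℕ) : ℤ)) ω) ∈
      S (l + 1)}).toReal = 1 - requestProb μ I R K d := by
    intro l
    have hms : MeasurableSet {ω | servedLabel K
        (I (-((l + 1 : ℕ) : ℤ)) ω, R (-((l + 1 : ℕ) : ℤ)) ω) = some d} :=
      h.measurable_request _ (MeasurableSet.of_discrete (s := {e | servedLabel K e = some d}))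
    rw [← h.servedLabel_prob (-((l + 1 : ℕ) : ℤ)) d, ← probReal_compl_eq_one_sub hms]
    rfl
  rw [measureReal_def, hset, h1, ENNReal.toReal_prod, Finset.prod_range_succ']
  simp only [Set.preimage, hl, Finset.prod_const, Finset.card_range]
  rw [mul_comm]
  congr 1
  simp [S, requestProb, measureReal_def]

theorem measurableSet_item (h : IsRequestModel μ I R α P) (k : Fin 2) (d : DataItem) :
    MeasurableSet {ω | I 0 ω = k ∧ R 0 ω = d} :=
  h.measurable_request 0
    (MeasurableSet.of_discrete (s := {e : Fin 2 × DataItem | e.1 = k ∧ e.2 = d}))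

theorem measurable_past (h : IsRequestModel μ I R α P) (l : ℕ) :
    Measurable fun ω => (I (-((l : ℤ) + 1)) ω, R (-((l : ℤ) + 1)) ω) :=
  h.measurable_request _

theorem measure_unseen (h : IsRequestModel μ I R α P) (k : Fin 2) (n : ℕ) :
    μ.real {ω | I 0 ω = k ∧ R 0 ω ∉ recent K (fun n => I n ω) (fun n => R n ω) n} =
      ∑' d, requestProb μ I R {k} d * (1 - requestProb μ I R K d) ^ n := by
  have hU : {ω | I 0 ω = k ∧ R 0 ω ∉ recent K (fun n => I n ω) (fun n => R n ω) n} =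
      ⋃ d, {ω | (I 0 ω = k ∧ R 0 ω = d) ∧
        d ∉ recent K (fun n => I n ω) (fun n => R n ω) n} := by
    ext ω
    simp only [Set.mem_ofPred_eq, Set.mem_iUnion]
    constructor
    · rintro ⟨h1, h2⟩
      exact ⟨R 0 ω, ⟨h1, rfl⟩, h2⟩
    · rintro ⟨d, ⟨h1, rfl⟩, h2⟩
      exact ⟨h1, h2⟩
  rw [hU, measureReal_def, measure_iUnion, ENNReal.tsum_toReal_eq fun d => measure_ne_top _ _]
  · exact tsum_congr fun d => h.measure_item_unseen k d n
  · intro a b hab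
    refine Set.disjoint_left.2 fun ω h1 h2 => hab ?_
    exact h1.1.2.symm.trans h2.1.2
  · intro d
    refine (h.measurableSet_item k d).inter ?_
    exact measurableSet_setOfPred.2 (measurable_seen_comp (lbl := servedLabel K)
      (Z := fun (l : ℕ) ω => (I (-(l + 1)) ω, R (-(l + 1)) ω)) h.measurable_past n
      fun s => d ∉ s)

/-- A miss is either unseen in the window or, being found there, has more than `y` distinct items in
the window. -/
theorem missProb_le (h : IsRequestModel μ I R α P) {β : ℝ} (hβ : 1 < β) (k : Fin 2) (n : ℕ) {y : ℝ} (hy : 0 < y)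
    (hs : Summable fun d => 1 - (1 - requestProb μ I R K d) ^ n) :
    missProb μ I R K k y ≤
      ∑' d, requestProb μ I R {k} d * (1 - requestProb μ I R K d) ^ n +
        Real.exp ((β - 1) * ∑' d, (1 - (1 - requestProb μ I R K d) ^ n) - y * Real.log β) := by
  have hdev : μ.real {ω | y < (recent K (fun n => I n ω) (fun n => R n ω) n).card} ≤
      Real.exp ((β - 1) * ∑' d, (1 - (1 - requestProb μ I R K d) ^ n) - y * Real.log β) :=
    measure_lt_card_seen_le h.measurable_past h.iIndepFun_past
      (fun _ d => h.servedLabel_prob _ d) hβ n hs y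
  rw [← h.measure_unseen k n]
  refine le_trans ?_ (add_le_add le_rfl hdev)
  refine le_trans (measureReal_mono ?_) (measureReal_union_le _ _)
  rintro ω ⟨hk, hm⟩
  by_cases h0 : R 0 ω ∈ recent K (fun n => I n ω) (fun n => R n ω) n
  · exact Or.inr (lt_card_recent_of_isMiss hy hm h0)
  · exact Or.inl ⟨hk, h0⟩

/-- An unseen item is a miss unless the window holds at most `y` distinct items. -/
theorem le_missProb (h : IsRequestModel μ I R α P) {β : ℝ} (hβ : 0 < β) (hβ1 : β < 1) (k : Fin 2) (n : ℕ) {y : ℝ} (hy : 0 < y)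
    (hs : Summable fun d => 1 - (1 - requestProb μ I R K d) ^ n) :
    ∑' d, requestProb μ I R {k} d * (1 - requestProb μ I R K d) ^ n ≤
      missProb μ I R K k y +
        Real.exp ((β - 1) * ∑' d, (1 - (1 - requestProb μ I R K d) ^ n) - y * Real.log β) := by
  have hdev : μ.real {ω | ((recent K (fun n => I n ω) (fun n => R n ω) n).card : ℝ) ≤ y} ≤
      Real.exp ((β - 1) * ∑' d, (1 - (1 - requestProb μ I R K d) ^ n) - y * Real.log β) :=
    measure_card_seen_le_le h.measurable_past h.iIndepFun_past
      (fun _ d => h.servedLabel_prob _ d) hβ hβ1 n hs y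
  rw [← h.measure_unseen k n]
  refine le_trans ?_ (add_le_add le_rfl hdev)
  refine le_trans (measureReal_mono ?_) (measureReal_union_le _ _)
  rintro ω ⟨hk, h0⟩
  by_cases hc : y < (recent K (fun n => I n ω) (fun n => R n ω) n).card
  · exact Or.inl ⟨hk, isMiss_of_lt_card_recent hy hc h0⟩
  · exact Or.inr (not_lt.1 hc)

theorem summable_requestProb (h : IsRequestModel μ I R α P) (K : Finset (Fin 2)) : Summable (requestProb μ I R K) :=
  summable_of_sum_le (requestProb_nonneg K)
    (sum_label_prob_le_one (lbl := servedLabel K)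
      (Z := fun (l : ℕ) ω => (I (-(l + 1)) ω, R (-(l + 1)) ω)) h.measurable_past
      fun _ d => h.servedLabel_prob _ d)

theorem requestProb_eq_sum (h : IsRequestModel μ I R α P) (K : Finset (Fin 2)) (d : DataItem) :
    requestProb μ I R K d = ∑ k ∈ K, requestProb μ I R {k} d := by
  have hU : {ω | I 0 ω ∈ K ∧ R 0 ω = d} = ⋃ k ∈ K, {ω | I 0 ω = k ∧ R 0 ω = d} := by
    ext ω
    simp
  rw [requestProb, hU, measureReal_biUnion_finset _ fun k _ => h.measurableSet_item k d]
  · simp [requestProb]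
  · intro a _ b _ hab
    exact Set.disjoint_left.2 fun ω h1 h2 => hab (h1.1.symm.trans h2.1)

/-- The asymptotic miss probability of flow `k` in a cache that serves the flows in `K`. -/
theorem tendsto_missProb (h : IsRequestModel μ I R α P) (hα : 1 < α) {a : Fin 2 → ItemClass → ℝ}
    (ha : ∀ k j, Tendsto (fun i : ℕ => requestProb μ I R {k} (j, i) * ((i : ℝ) + 1) ^ α) atTop
      (𝓝 (a k j))) {k : Fin 2} (hk : k ∈ K) (hpos : ∃ j, 0 < a k j) :
    Tendsto (fun y => y ^ (α - 1) * missProb μ I R K k y) atTop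
      (𝓝 (missConst α * (∑ j, a k j / (∑ l ∈ K, a l j) * (∑ l ∈ K, a l j) ^ (1 / α)) *
        (distinctConst α * ∑ j, (∑ l ∈ K, a l j) ^ (1 / α)) ^ (α - 1))) := by
  have hb : ∀ j, Tendsto (fun i : ℕ => requestProb μ I R K (j, i) * ((i : ℝ) + 1) ^ α) atTop
      (𝓝 (∑ l ∈ K, a l j)) := by
    intro j
    refine (tendsto_finsetSum K fun l _ => ha l j).congr fun i => ?_
    rw [h.requestProb_eq_sum K, Finset.sum_mul]
  have hr0 : ∀ l d, 0 ≤ requestProb μ I R {l} d := fun l d => requestProb_nonneg _ d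
  have hq0 : ∀ d, 0 ≤ requestProb μ I R K d := fun d => requestProb_nonneg _ d
  have hq1 : ∀ d, requestProb μ I R K d ≤ 1 := fun d => measureReal_le_one
  have ha0 : ∀ l j, 0 ≤ a l j := fun l j => limit_nonneg (fun i => hr0 l (j, i)) (ha l j)
  have hrq : ∀ d, requestProb μ I R {k} d ≤ requestProb μ I R K d := fun d => by
    rw [h.requestProb_eq_sum K]
    exact Finset.single_le_sum (f := fun l => requestProb μ I R {l} d) (fun l _ => hr0 l d) hk
  have hs : ∀ n : ℕ, Summable fun d => 1 - (1 - requestProb μ I R K d) ^ n := fun n =>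
    (tsum_classes (distinct_nonneg hq0 hq1 n) fun j => summable_distinct hα
      (fun i => hq0 (j, i)) (fun i => hq1 (j, i)) (hb j) n).1
  have hM : 0 < distinctConst α * ∑ j, (∑ l ∈ K, a l j) ^ (1 / α) := by
    refine mul_pos (distinctConst_pos hα) ?_
    obtain ⟨j, hj⟩ := hpos
    refine Finset.sum_pos' (fun j _ => Real.rpow_nonneg (Finset.sum_nonneg fun l _ => ha0 l j) _)
      ⟨j, Finset.mem_univ j, Real.rpow_pos_of_pos ?_ _⟩
    exact Finset.sum_pos' (fun l _ => ha0 l j) ⟨k, hk, hj⟩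
  exact tendsto_of_sandwich hα hM (tendsto_distinct_classes hα hq0 hq1 hb)
    (tendsto_unseen_classes hα (hr0 k) hrq hq1 (h.summable_requestProb {k}) (ha k) hb)
    (fun β hβ n y hy => h.missProb_le hβ k n hy (hs n))
    (fun β hβ hβ1 n y hy => h.le_missProb hβ hβ1 k n hy (hs n))

end IsRequestModel

end Model

/-! ### Optimal division of a cache under power-law miss probabilities. -/

section Optimization

variable {α κ : ℝ} {w u v : Fin 2 → ℝ} {G : Fin 2 → ℝ → ℝ}

/-- The static separation with fractions proportional to `w`. -/
def proportionalSeparation (w : Fin 2 → ℝ) (k : Fin 2) : ℝ := w k / ∑ l, w l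

theorem proportionalSeparation_pos (hw : ∀ k, 0 < w k) (k : Fin 2) :
    0 < proportionalSeparation w k :=
  div_pos (hw k) (Finset.sum_pos (fun l _ => hw l) Finset.univ_nonempty)

theorem isSeparation_proportional (hw : ∀ k, 0 < w k) :
    IsSeparation (proportionalSeparation w) := by
  refine ⟨fun k => (proportionalSeparation_pos hw k).le, ?_⟩
  have : 0 < ∑ l, w l := Finset.sum_pos (fun l _ => hw l) Finset.univ_nonempty
  simp only [proportionalSeparation]
  rw [← Finset.sum_div, div_self this.ne']

theorem rpow_mul_rpow_neg_eq {x y : ℝ} (hx : 0 < x) (hy : 0 < y) :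
    x ^ α * y ^ (-(α - 1)) = y * (x / y) ^ α := by
  rw [Real.div_rpow hx.le hy.le, Real.rpow_neg hy.le, Real.rpow_sub hy, Real.rpow_one]
  have := (Real.rpow_pos_of_pos hy α).ne'
  field_simp

theorem sum_rpow_proportional (hw : ∀ k, 0 < w k) :
    ∑ k, w k ^ α * proportionalSeparation w k ^ (-(α - 1)) = (∑ l, w l) ^ α := by
  have hW : 0 < ∑ l, w l := Finset.sum_pos (fun l _ => hw l) Finset.univ_nonempty
  have : ∀ k, w k ^ α * proportionalSeparation w k ^ (-(α - 1)) =
      proportionalSeparation w k * (∑ l, w l) ^ α := by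
    intro k
    rw [rpow_mul_rpow_neg_eq (hw k) (proportionalSeparation_pos hw k)]
    congr 2
    rw [proportionalSeparation, div_div_cancel₀ (hw k).ne']
  simp_rw [this]
  rw [← Finset.sum_mul, (isSeparation_proportional hw).2, one_mul]

/-- Jensen's inequality for the power α, with weights `v k` at the points `w k / v k`, whose mean is
the sum of `w`. -/
theorem sum_rpow_le (hα : 1 < α) (hw : ∀ k, 0 < w k) (hv : IsSeparation v) (hv0 : ∀ k, 0 < v k) :
    (∑ l, w l) ^ α ≤ ∑ k, w k ^ α * v k ^ (-(α - 1)) := by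
  simp_rw [fun k => rpow_mul_rpow_neg_eq (α := α) (hw k) (hv0 k)]
  have h := (convexOn_rpow hα.le).map_sum_le (t := Finset.univ) (w := v) (p := fun k => w k / v k)
    (fun k _ => hv.1 k) hv.2 (fun k _ => (div_pos (hw k) (hv0 k)).le)
  simpa only [smul_eq_mul, mul_div_cancel₀ _ (hv0 _).ne'] using h

/-- Equality in Jensen's inequality forces the two ratios `w k / v k` to agree, by strict convexity.
-/
theorem eq_proportionalSeparation (hα : 1 < α) (hw : ∀ k, 0 < w k) (hv : IsSeparation v)
    (hv0 : ∀ k, 0 < v k) (hle : ∑ k, w k ^ α * v k ^ (-(α - 1)) ≤ (∑ l, w l) ^ α) :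
    v = proportionalSeparation w := by
  have heq : w 0 / v 0 = w 1 / v 1 := by
    by_contra hne
    have h := (strictConvexOn_rpow hα).2 (div_pos (hw 0) (hv0 0)).le (div_pos (hw 1) (hv0 1)).le
      hne (hv0 0) (hv0 1) (by simpa [Fin.sum_univ_two] using hv.2)
    simp only [smul_eq_mul, mul_div_cancel₀ _ (hv0 _).ne'] at h
    simp only [fun k => rpow_mul_rpow_neg_eq (α := α) (hw k) (hv0 k), Fin.sum_univ_two] at hle
    exact absurd hle (not_le.2 h)
  have hsum := hv.2
  have h0 := hv0 0
  have h1 := hv0 1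
  have hw0 := hw 0
  have hw1 := hw 1
  rw [Fin.sum_univ_two] at hsum
  rw [div_eq_div_iff h0.ne' h1.ne'] at heq
  ext k
  rw [proportionalSeparation, Fin.sum_univ_two, eq_div_iff (by positivity)]
  fin_cases k
  · simp only [Fin.zero_eta]
    linear_combination -heq + w 0 * hsum
  · simp only [Fin.mk_one]
    linear_combination heq + w 1 * hsum

theorem tendsto_sum_scaled (hv0 : ∀ k, 0 < v k)
    (hG : ∀ k, Tendsto (fun y => y ^ (α - 1) * G k y) atTop (𝓝 (κ * w k ^ α))) :
    Tendsto (fun x => x ^ (α - 1) * ∑ k, G k (v k * x)) atTop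
      (𝓝 (κ * ∑ k, w k ^ α * v k ^ (-(α - 1)))) := by
  have h := tendsto_finsetSum (Finset.univ : Finset (Fin 2)) fun k _ =>
    ((hG k).comp (tendsto_id.const_mul_atTop (hv0 k))).mul_const (v k ^ (-(α - 1)))
  simp_rw [mul_assoc] at h
  rw [← Finset.mul_sum] at h
  refine h.congr' ?_
  filter_upwards [eventually_gt_atTop 0] with x hx
  rw [Finset.mul_sum]
  refine Finset.sum_congr rfl fun k _ => ?_
  simp only [Function.comp_apply, id]
  rw [Real.mul_rpow (hv0 k).le hx.le, Real.rpow_neg (hv0 k).le]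
  have := (Real.rpow_pos_of_pos (hv0 k) (α - 1)).ne'
  field_simp

theorem tendsto_zero_of_tendsto_rpow_mul (hα : 1 < α) {f : ℝ → ℝ} {c : ℝ}
    (hf : Tendsto (fun x => x ^ (α - 1) * f x) atTop (𝓝 c)) : Tendsto f atTop (𝓝 0) := by
  refine (hf.div_atTop (tendsto_rpow_atTop (by linarith : 0 < α - 1))).congr' ?_
  filter_upwards [eventually_gt_atTop 0] with x hx
  exact mul_div_cancel_left₀ _ (Real.rpow_pos_of_pos hx _).ne'

/-- A flow with fraction 0 keeps a cache of size 0 for every `x`, so its contribution does not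
decay. Such separations lose against any with positive fractions. -/
theorem zero_lt_of_not_forall_pos (hG0 : ∀ k y, 0 ≤ G k y) (hGz : ∀ k, 0 < G k 0)
    (hv : IsSeparation v) (hv0 : ¬ ∀ k, 0 < v k) :
    ∃ δ, 0 < δ ∧ ∀ x, δ ≤ ∑ k, G k (v k * x) := by
  push Not at hv0
  obtain ⟨k, hk⟩ := hv0
  refine ⟨G k 0, hGz k, fun x => ?_⟩
  have := Finset.single_le_sum (f := fun k => G k (v k * x)) (fun l _ => hG0 l _)
    (Finset.mem_univ k)
  simpa [le_antisymm hk (hv.1 k)] using this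

/-- The proportional separation is asymptotically optimal. -/
theorem eventually_sum_proportional_le (hα : 1 < α) (hκ : 0 < κ) (hw : ∀ k, 0 < w k)
    (hG0 : ∀ k y, 0 ≤ G k y) (hGz : ∀ k, 0 < G k 0)
    (hG : ∀ k, Tendsto (fun y => y ^ (α - 1) * G k y) atTop (𝓝 (κ * w k ^ α)))
    (hv : IsSeparation v) {ε : ℝ} (hε : 0 < ε) :
    ∀ᶠ x in atTop, ∑ k, G k (proportionalSeparation w k * x) ≤
      (1 + ε) * ∑ k, G k (v k * x) := by
  have hu := tendsto_sum_scaled (proportionalSeparation_pos hw) hG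
  by_cases hv0 : ∀ k, 0 < v k
  · have hlim := (tendsto_sum_scaled hv0 hG).const_mul (1 + ε)
    have hlt : κ * ∑ k, w k ^ α * proportionalSeparation w k ^ (-(α - 1)) <
        (1 + ε) * (κ * ∑ k, w k ^ α * v k ^ (-(α - 1))) := by
      rw [sum_rpow_proportional hw]
      have h1 := sum_rpow_le hα hw hv hv0
      have hW : 0 < ∑ l, w l := Finset.sum_pos (fun l _ => hw l) Finset.univ_nonempty
      have h2 : 0 < (∑ l, w l) ^ α := Real.rpow_pos_of_pos hW α
      have h3 : 0 < κ * (∑ l, w l) ^ α := by positivity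
      have h4 := mul_le_mul_of_nonneg_left h1 hκ.le
      nlinarith
    filter_upwards [hu.eventually_lt hlim hlt, eventually_gt_atTop 0] with x hx hx0
    rw [mul_left_comm] at hx
    exact (lt_of_mul_lt_mul_left hx (Real.rpow_nonneg hx0.le _)).le
  · obtain ⟨δ, hδ, hle⟩ := zero_lt_of_not_forall_pos hG0 hGz hv hv0
    filter_upwards [(tendsto_zero_of_tendsto_rpow_mul hα hu).eventually_lt_const hδ] with x hx
    have := hle x
    nlinarith

/-- Comparison with the proportional separation alone suffices: its cost tends to 0, which rules out
zero fractions, and comparing the scaled limits then leads to the equality case of Jensen's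
inequality. -/
theorem eq_proportionalSeparation_of_optimal (hα : 1 < α) (hκ : 0 < κ) (hw : ∀ k, 0 < w k)
    (hG0 : ∀ k y, 0 ≤ G k y) (hGz : ∀ k, 0 < G k 0)
    (hG : ∀ k, Tendsto (fun y => y ^ (α - 1) * G k y) atTop (𝓝 (κ * w k ^ α)))
    (hu : IsSeparation u) (hopt : ∀ ε > 0, ∀ᶠ x in atTop,
      ∑ k, G k (u k * x) ≤ (1 + ε) * ∑ k, G k (proportionalSeparation w k * x)) :
    u = proportionalSeparation w := by
  have hp := tendsto_sum_scaled (proportionalSeparation_pos hw) hG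
  have hu0 : ∀ k, 0 < u k := by
    by_contra hcon
    obtain ⟨δ, hδ, hle⟩ := zero_lt_of_not_forall_pos hG0 hGz hu hcon
    obtain ⟨x, h1, h2⟩ := ((hopt 1 one_pos).and
      ((tendsto_zero_of_tendsto_rpow_mul hα hp).eventually_lt_const (half_pos hδ))).exists
    have := hle x
    linarith
  refine eq_proportionalSeparation hα hw hu hu0 ?_
  rw [← sum_rpow_proportional hw]
  refine le_of_mul_le_mul_left (le_of_forall_pos_le_add fun ε hε => ?_) hκ
  set c := κ * ∑ k, w k ^ α * proportionalSeparation w k ^ (-(α - 1)) with hc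
  have hc0 : 0 < c := mul_pos hκ (Finset.sum_pos (fun k _ =>
    mul_pos (Real.rpow_pos_of_pos (hw k) _)
      (Real.rpow_pos_of_pos (proportionalSeparation_pos hw k) _)) Finset.univ_nonempty)
  -- The relative slack `ε / c` becomes the absolute slack `ε` after multiplication by the limit
  -- `c`.
  have h := le_of_tendsto_of_tendsto (tendsto_sum_scaled hu0 hG) (hp.const_mul (1 + ε / c)) (by
    filter_upwards [hopt (ε / c) (div_pos hε hc0), eventually_gt_atTop 0] with x hx hx0
    rw [mul_left_comm]
    exact mul_le_mul_of_nonneg_left hx (Real.rpow_nonneg hx0.le _))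
  rwa [add_mul, one_mul, div_mul_cancel₀ _ hc0.ne'] at h

end Optimization

/-! ### Comparison of the pooled and separate coefficients. -/

section Coefficients

variable {α s x y : ℝ} {a : Fin 2 → ItemClass → ℝ} {k : Fin 2}

theorem sum_itemClass (f : ItemClass → ℝ) : ∑ j, f j = f .A + f .B + f .D := by
  rw [show (Finset.univ : Finset ItemClass) = {.A, .B, .D} from rfl]
  rw [Finset.sum_insert (by decide), Finset.sum_insert (by decide), Finset.sum_singleton, add_assoc]

/-- The order of magnitude of the number of items met by the flows in `K`. -/
def sizeCoef (α : ℝ) (a : Fin 2 → ItemClass → ℝ) (K : Finset (Fin 2)) : ℝ :=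
  ∑ j, (∑ l ∈ K, a l j) ^ (1 / α)

/-- The order of magnitude of the share of flow `k` in the requests for items not met recently. -/
def shareCoef (α : ℝ) (a : Fin 2 → ItemClass → ℝ) (K : Finset (Fin 2)) (k : Fin 2) : ℝ :=
  ∑ j, a k j / (∑ l ∈ K, a l j) * (∑ l ∈ K, a l j) ^ (1 / α)

/-- The left side is x y^(s-1), and a negative power decreases. -/
theorem div_mul_rpow_lt (hs : s < 1) (hx : 0 < x) (hxy : x < y) : x / y * y ^ s < x ^ s := by
  have hy := hx.trans hxy
  have h := Real.rpow_lt_rpow_of_neg hx hxy (by linarith : s - 1 < 0)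
  have h2 := mul_lt_mul_of_pos_left h hx
  rw [Real.rpow_sub hx, Real.rpow_sub hy, Real.rpow_one, Real.rpow_one,
    mul_div_cancel₀ _ hx.ne'] at h2
  calc x / y * y ^ s = x * (y ^ s / y) := by ring
    _ < x ^ s := h2

theorem div_mul_rpow_le (hs : s < 1) (hs0 : 0 < s) (hx : 0 ≤ x) (hxy : x ≤ y) :
    x / y * y ^ s ≤ x ^ s := by
  rcases hx.eq_or_lt with rfl | hx
  · simp [Real.zero_rpow hs0.ne']
  rcases hxy.eq_or_lt with rfl | hxy
  · rw [div_self hx.ne', one_mul]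
  · exact (div_mul_rpow_lt hs hx hxy).le

theorem shareCoef_singleton (hα : 1 < α) : shareCoef α a {k} k = sizeCoef α a {k} := by
  refine Finset.sum_congr rfl fun j _ => ?_
  rw [Finset.sum_singleton]
  rcases eq_or_ne (a k j) 0 with h | h
  · simp [h, Real.zero_rpow (inv_ne_zero (by linarith : α ≠ 0))]
  · rw [div_self h, one_mul]

/-- Sharing never raises a class's term, and it strictly lowers that of class `D`, where the other
flow contributes too. -/
theorem shareCoef_univ_lt (hα : 1 < α) (ha : ∀ k j, 0 ≤ a k j) (hD : ∀ k, 0 < a k .D)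
    (k : Fin 2) : shareCoef α a Finset.univ k < sizeCoef α a {k} := by
  have hs1 : 1 / α < 1 := by rw [div_lt_one (by linarith)]; exact hα
  have hs0 : 0 < 1 / α := by positivity
  refine Finset.sum_lt_sum (fun j _ => ?_) ⟨.D, Finset.mem_univ _, ?_⟩
  · rw [Finset.sum_singleton]
    exact div_mul_rpow_le hs1 hs0 (ha k j)
      (Finset.single_le_sum (f := fun l => a l j) (fun l _ => ha l j) (Finset.mem_univ k))
  · rw [Finset.sum_singleton]
    refine div_mul_rpow_lt hs1 (hD k) ?_
    have h0 := hD 0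
    have h1 := hD 1
    fin_cases k <;> simp [Fin.sum_univ_two, h0, h1]

/-- The shares within each class add up to one; a class with total zero contributes nothing to
either side. -/
theorem sum_shareCoef (hα : 1 < α) : ∑ k, shareCoef α a Finset.univ k = sizeCoef α a Finset.univ := by
  simp only [shareCoef, sizeCoef]
  rw [Finset.sum_comm]
  refine Finset.sum_congr rfl fun j _ => ?_
  rw [← Finset.sum_mul, ← Finset.sum_div]
  rcases eq_or_ne (∑ l, a l j) 0 with h | h
  · rw [h, Real.zero_rpow (one_div_ne_zero (by linarith)), mul_zero]
  · rw [div_self h, one_mul]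

theorem sizeCoef_nonneg (ha : ∀ k j, 0 ≤ a k j) (K : Finset (Fin 2)) : 0 ≤ sizeCoef α a K :=
  Finset.sum_nonneg fun j _ => Real.rpow_nonneg (Finset.sum_nonneg fun l _ => ha l j) _

theorem sizeCoef_singleton_pos (ha : ∀ k j, 0 ≤ a k j) (hD : ∀ k, 0 < a k .D) (k : Fin 2) :
    0 < sizeCoef α a {k} := by
  refine Finset.sum_pos' (fun j _ => Real.rpow_nonneg (Finset.sum_nonneg fun l _ => ha l j) _)
    ⟨.D, Finset.mem_univ _, ?_⟩
  rw [Finset.sum_singleton]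
  exact Real.rpow_pos_of_pos (hD k) _

/-- With W the sum of the w_k, the fraction w_k/W gives (w_k/W)^(α-1) w_k W^(α-1) = w_k^α. Pooling
replaces w_k by the smaller share and W by the sum of the shares, which is smaller as well. -/
theorem proportional_pool_lt (hα : 1 < α) (ha : ∀ k j, 0 ≤ a k j) (hD : ∀ k, 0 < a k .D)
    (k : Fin 2) :
    proportionalSeparation (fun l => sizeCoef α a {l}) k ^ (α - 1) *
      (shareCoef α a Finset.univ k * sizeCoef α a Finset.univ ^ (α - 1)) <
      sizeCoef α a {k} ^ α := by
  have hw : ∀ l, 0 < sizeCoef α a {l} := sizeCoef_singleton_pos ha hD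
  have hW : 0 < ∑ l, sizeCoef α a {l} := Finset.sum_pos (fun l _ => hw l) Finset.univ_nonempty
  have hSW : sizeCoef α a Finset.univ < ∑ l, sizeCoef α a {l} := by
    rw [← sum_shareCoef hα]
    exact Finset.sum_lt_sum_of_nonempty Finset.univ_nonempty
      fun l _ => shareCoef_univ_lt hα ha hD l
  have hS0 : 0 ≤ sizeCoef α a Finset.univ := sizeCoef_nonneg ha _
  have hpow : sizeCoef α a Finset.univ ^ (α - 1) < (∑ l, sizeCoef α a {l}) ^ (α - 1) :=
    Real.rpow_lt_rpow hS0 hSW (by linarith)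
  have hp : 0 < proportionalSeparation (fun l => sizeCoef α a {l}) k ^ (α - 1) :=
    Real.rpow_pos_of_pos (proportionalSeparation_pos hw k) _
  calc _ ≤ proportionalSeparation (fun l => sizeCoef α a {l}) k ^ (α - 1) *
        (sizeCoef α a {k} * sizeCoef α a Finset.univ ^ (α - 1)) := by
        refine mul_le_mul_of_nonneg_left (mul_le_mul_of_nonneg_right
          (shareCoef_univ_lt hα ha hD k).le (Real.rpow_nonneg hS0 _)) hp.le
    _ < proportionalSeparation (fun l => sizeCoef α a {l}) k ^ (α - 1) *
        (sizeCoef α a {k} * (∑ l, sizeCoef α a {l}) ^ (α - 1)) :=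
        mul_lt_mul_of_pos_left (mul_lt_mul_of_pos_left hpow (hw k)) hp
    _ = sizeCoef α a {k} ^ α := by
        rw [proportionalSeparation, Real.div_rpow (hw k).le hW.le, Real.rpow_sub (hw k),
          Real.rpow_one]
        have h1 := (Real.rpow_pos_of_pos hW (α - 1)).ne'
        have h2 := (hw k).ne'
        field_simp

end Coefficients

/-! ### The good region in terms of the coefficients. -/

section GoodRegion

variable {α : ℝ} {P : Params} {u : Fin 2 → ℝ}

/-- The Zipf constants of the unconditional request probabilities. -/
def requestCoef (P : Params) : Fin 2 → ItemClass → ℝ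
  | 0, .A => P.cA * P.pA₁ * P.ν₁
  | 0, .B => 0
  | 0, .D => P.cD * P.pD₁ * P.ν₁
  | 1, .A => 0
  | 1, .B => P.cB * P.pB₂ * P.ν₂
  | 1, .D => P.cD * P.pD₂ * P.ν₂

theorem requestCoef_nonneg (hP : P.Pos) (k : Fin 2) (j : ItemClass) : 0 ≤ requestCoef P k j := by
  obtain ⟨h1, h2, h3, h4, h5, h6, h7, h8, h9⟩ := hP
  fin_cases k <;> cases j <;> simp only [requestCoef] <;> positivity

theorem requestCoef_D_pos (hP : P.Pos) (k : Fin 2) : 0 < requestCoef P k .D := by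
  obtain ⟨h1, h2, h3, h4, h5, h6, h7, h8, h9⟩ := hP
  fin_cases k <;> simp only [requestCoef] <;> positivity

/-- Multiplying by `ν` passes from conditional to joint Zipf constants: on the right it enters the
α-th power as ν^(1/α), and on the left it supplies the missing factors ν^s and ν. -/
theorem good_inequality_iff {s ν x c p Q S U : ℝ} (hα : 1 < α) (hs : s = 1 / α) (hν : 0 < ν)
    (hx : 0 < x) (hc : 0 < c) (hp : 0 < p) (hQ : 0 < Q) (hS : 0 < S) :
    U * (x ^ s / ν ^ (1 - s) + c ^ s * p / Q ^ (1 - s)) < (x ^ s + (c * p) ^ s) ^ α / S ^ (α - 1) ↔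
      U * (((x * ν) ^ s + c * p * ν / (c * Q) * (c * Q) ^ s) * S ^ (α - 1)) <
        ((x * ν) ^ s + (c * p * ν) ^ s) ^ α := by
  have hα0 : α ≠ 0 := by linarith
  have h1 : (x * ν) ^ s + c * p * ν / (c * Q) * (c * Q) ^ s =
      ν * (x ^ s / ν ^ (1 - s) + c ^ s * p / Q ^ (1 - s)) := by
    rw [Real.mul_rpow hx.le hν.le, Real.mul_rpow hc.le hQ.le, Real.rpow_sub hν, Real.rpow_sub hQ,
      Real.rpow_one, Real.rpow_one]
    have := (Real.rpow_pos_of_pos hν s).ne'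
    have := (Real.rpow_pos_of_pos hQ s).ne'
    field_simp
  have h2 : ((x * ν) ^ s + (c * p * ν) ^ s) ^ α = ν * (x ^ s + (c * p) ^ s) ^ α := by
    rw [Real.mul_rpow hx.le hν.le, Real.mul_rpow (mul_pos hc hp).le hν.le, ← add_mul,
      Real.mul_rpow (by positivity) (by positivity), ← Real.rpow_mul hν.le, hs,
      one_div_mul_cancel hα0, Real.rpow_one, mul_comm]
  have hS' : 0 < S ^ (α - 1) := Real.rpow_pos_of_pos hS _
  rw [h1, h2, lt_div_iff₀ hS', ← mul_lt_mul_iff_right₀ hν]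
  ring_nf

theorem mem_goodRegion_iff (hα : 1 < α) (hP : P.Pos) : P ∈ goodRegion α u ↔
    ∀ k, u k ^ (α - 1) * (shareCoef α (requestCoef P) Finset.univ k *
      sizeCoef α (requestCoef P) Finset.univ ^ (α - 1)) <
        sizeCoef α (requestCoef P) {k} ^ α := by
  have hP' := hP
  obtain ⟨h1, h2, h3, h4, h5, h6, h7, h8, h9⟩ := hP
  have hα0 : α ≠ 0 := by linarith
  have hz : (0 : ℝ) ^ (1 / α) = 0 := Real.zero_rpow (one_div_ne_zero hα0)
  have hQ : 0 < P.pDstar := by unfold Params.pDstar; positivity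
  have hQ' : P.cD * P.pD₁ * P.ν₁ + P.cD * P.pD₂ * P.ν₂ = P.cD * P.pDstar := by
    unfold Params.pDstar; ring
  have hxA : 0 < P.cA * P.pA₁ * P.ν₁ := by positivity
  have hxB : 0 < P.cB * P.pB₂ * P.ν₂ := by positivity
  have hsw : P.swap.pDstar = P.pDstar := by
    simp only [Params.pDstar, Params.swap]; ring
  have hS : sizeCoef α (requestCoef P) Finset.univ = (P.cA * P.pA₁ * P.ν₁) ^ (1 / α) +
      (P.cB * P.pB₂ * P.ν₂) ^ (1 / α) + (P.cD * P.pDstar) ^ (1 / α) := by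
    simp only [sizeCoef, sum_itemClass, Fin.sum_univ_two, requestCoef, add_zero, zero_add, hQ']
  have hSpos : 0 < sizeCoef α (requestCoef P) Finset.univ := by rw [hS]; positivity
  have hw0 : sizeCoef α (requestCoef P) {0} = (P.cA * P.pA₁ * P.ν₁) ^ (1 / α) +
      (P.cD * P.pD₁ * P.ν₁) ^ (1 / α) := by
    simp only [sizeCoef, sum_itemClass, Finset.sum_singleton, requestCoef, hz, add_zero]
  have hw1 : sizeCoef α (requestCoef P) {1} = (P.cB * P.pB₂ * P.ν₂) ^ (1 / α) +
      (P.cD * P.pD₂ * P.ν₂) ^ (1 / α) := by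
    simp only [sizeCoef, sum_itemClass, Finset.sum_singleton, requestCoef, hz, zero_add]
  have hT0 : shareCoef α (requestCoef P) Finset.univ 0 = (P.cA * P.pA₁ * P.ν₁) ^ (1 / α) +
      P.cD * P.pD₁ * P.ν₁ / (P.cD * P.pDstar) * (P.cD * P.pDstar) ^ (1 / α) := by
    simp only [shareCoef, sum_itemClass, Fin.sum_univ_two, requestCoef, add_zero, zero_add, hQ',
      zero_div, zero_mul, div_self hxA.ne', one_mul]
  have hT1 : shareCoef α (requestCoef P) Finset.univ 1 = (P.cB * P.pB₂ * P.ν₂) ^ (1 / α) +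
      P.cD * P.pD₂ * P.ν₂ / (P.cD * P.pDstar) * (P.cD * P.pDstar) ^ (1 / α) := by
    simp only [shareCoef, sum_itemClass, Fin.sum_univ_two, requestCoef, add_zero, zero_add, hQ',
      zero_div, zero_mul, div_self hxB.ne', one_mul]
  have hg0 : P.GoodForFlow₁ α (u 0) ↔ u 0 ^ (α - 1) *
      (shareCoef α (requestCoef P) Finset.univ 0 *
        sizeCoef α (requestCoef P) Finset.univ ^ (α - 1)) <
          sizeCoef α (requestCoef P) {0} ^ α := by
    rw [hT0, hw0, ← good_inequality_iff hα rfl h1 (by positivity) h5 h8 hQ hSpos, hS]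
    rfl
  have hg1 : P.swap.GoodForFlow₁ α (u 1) ↔ u 1 ^ (α - 1) *
      (shareCoef α (requestCoef P) Finset.univ 1 *
        sizeCoef α (requestCoef P) Finset.univ ^ (α - 1)) <
          sizeCoef α (requestCoef P) {1} ^ α := by
    -- Exchanging the flows permutes the first two terms of the pooled size and leaves `pDstar`
    -- unchanged.
    rw [hT1, hw1, ← good_inequality_iff hα rfl h2 (by positivity) h5 h9 hQ hSpos, hS,
      add_comm ((P.cA * P.pA₁ * P.ν₁) ^ (1 / α)), Params.GoodForFlow₁, hsw]
    rfl
  rw [Fin.forall_fin_two, ← hg0, ← hg1]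
  exact ⟨fun h => h.2, fun h => ⟨hP', h⟩⟩

end GoodRegion

/-! ### Zipf constants of the request model and the limiting ratio. -/

section Zipf

theorem cond_real_eq {Ω : Type*} [MeasurableSpace Ω] (μ : Measure Ω) {S : Set Ω}
    (hS : MeasurableSet S) (T : Set Ω) : (μ[|S]).real T = (μ.real S)⁻¹ * μ.real (S ∩ T) := by
  rw [measureReal_def, cond_apply hS, ENNReal.toReal_mul, ENNReal.toReal_inv, measureReal_def,
    measureReal_def]

theorem tendsto_mul_of_isEquivalent_zipf {α c : ℝ} {f : ℕ → ℝ}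
    (hf : f ~[atTop] fun i : ℕ => c / ((i : ℝ) + 1) ^ α) :
    Tendsto (fun i : ℕ => f i * ((i : ℝ) + 1) ^ α) atTop (𝓝 c) := by
  obtain ⟨φ, hφ, hfφ⟩ := hf.exists_eq_mul
  have h := hφ.mul_const c
  rw [one_mul] at h
  refine h.congr' ?_
  filter_upwards [hfφ] with i hi
  have : (((i : ℝ) + 1) ^ α) ≠ 0 := (Real.rpow_pos_of_pos (by positivity) α).ne'
  rw [hi, Pi.mul_apply]
  field_simp

variable {Ω : Type*} [MeasurableSpace Ω] {μ : Measure Ω} [IsProbabilityMeasure μ]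
  {I : ℤ → Ω → Fin 2} {R : ℤ → Ω → DataItem} {α : ℝ} {P : Params}

/-- The probability that a request comes from flow `k`. -/
def Params.flowProb (P : Params) : Fin 2 → ℝ
  | 0 => P.ν₁
  | 1 => P.ν₂

theorem Params.Pos.flowProb_pos (hP : P.Pos) (k : Fin 2) : 0 < P.flowProb k := by
  fin_cases k
  exacts [hP.1, hP.2.1]

namespace IsRequestModel

theorem measurableSet_request (h : IsRequestModel μ I R α P) (S : Set (Fin 2 × DataItem)) :
    MeasurableSet {ω | (I 0 ω, R 0 ω) ∈ S} :=
  h.measurable_request 0 (MeasurableSet.of_discrete (s := S))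

theorem measurableSet_flow (h : IsRequestModel μ I R α P) (k : Fin 2) :
    MeasurableSet {ω | I 0 ω = k} :=
  h.measurableSet_request {e | e.1 = k}

theorem measurableSet_class (h : IsRequestModel μ I R α P) (k : Fin 2) (j : ItemClass) :
    MeasurableSet {ω | I 0 ω = k ∧ (R 0 ω).1 = j} :=
  h.measurableSet_request {e | e.1 = k ∧ e.2.1 = j}

theorem measure_flow (h : IsRequestModel μ I R α P) (k : Fin 2) :
    μ.real {ω | I 0 ω = k} = P.flowProb k := by
  fin_cases k
  exacts [h.flow₁, h.flow₂]

theorem measure_class (h : IsRequestModel μ I R α P) (hP : P.Pos) {k : Fin 2} {j : ItemClass}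
    {p : ℝ} (hp : (μ[|{ω | I 0 ω = k}]).real {ω | (R 0 ω).1 = j} = p) :
    μ.real {ω | I 0 ω = k ∧ (R 0 ω).1 = j} = p * P.flowProb k := by
  rw [cond_real_eq μ (h.measurableSet_flow k), h.measure_flow,
    inv_mul_eq_iff_eq_mul₀ (hP.flowProb_pos k).ne'] at hp
  rw [mul_comm, ← hp]
  rfl

theorem tendsto_requestProb (h : IsRequestModel μ I R α P) {k : Fin 2} {j : ItemClass} {w c : ℝ}
    (hw : μ.real {ω | I 0 ω = k ∧ (R 0 ω).1 = j} = w) (hw0 : w ≠ 0)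
    (hz : (fun i : ℕ => (μ[|{ω | I 0 ω = k ∧ (R 0 ω).1 = j}]).real {ω | R 0 ω = (j, i)})
      ~[atTop] fun i : ℕ => c / ((i : ℝ) + 1) ^ α) :
    Tendsto (fun i : ℕ => requestProb μ I R {k} (j, i) * ((i : ℝ) + 1) ^ α) atTop
      (𝓝 (c * w)) := by
  rw [mul_comm]
  refine ((tendsto_mul_of_isEquivalent_zipf hz).const_mul w).congr fun i => ?_
  rw [cond_real_eq μ (h.measurableSet_class k j), hw, ← mul_assoc, mul_inv_cancel_left₀ hw0,
    requestProb]
  congr 2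
  ext ω
  simp only [Set.mem_inter_iff, Set.mem_ofPred_eq, Finset.mem_singleton]
  constructor
  · rintro ⟨⟨h1, _⟩, h2⟩
    exact ⟨h1, h2⟩
  · rintro ⟨h1, h2⟩
    exact ⟨⟨h1, by rw [h2]⟩, h2⟩

/-- The two classes `j₁` and `j₂` already exhaust the probability of flow `k`, so a third class has
probability zero. -/
theorem requestProb_eq_zero (h : IsRequestModel μ I R α P) {k : Fin 2} {j j₁ j₂ : ItemClass}
    {p₁ p₂ : ℝ} (h1 : μ.real {ω | I 0 ω = k ∧ (R 0 ω).1 = j₁} = p₁ * P.flowProb k)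
    (h2 : μ.real {ω | I 0 ω = k ∧ (R 0 ω).1 = j₂} = p₂ * P.flowProb k) (hp : p₁ + p₂ = 1)
    (hj₁ : j ≠ j₁) (hj₂ : j ≠ j₂) (hj : j₁ ≠ j₂) (i : ℕ) : requestProb μ I R {k} (j, i) = 0 := by
  have hd : ∀ a b : ItemClass, a ≠ b →
      Disjoint {ω | I 0 ω = k ∧ (R 0 ω).1 = a} {ω | I 0 ω = k ∧ (R 0 ω).1 = b} := fun a b hab =>
    Set.disjoint_left.2 fun ω ha hb => hab (ha.2.symm.trans hb.2)
  have hsum := measureReal_mono (μ := μ) (s₁ := ({ω | I 0 ω = k ∧ (R 0 ω).1 = j} ∪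
    {ω | I 0 ω = k ∧ (R 0 ω).1 = j₁}) ∪ {ω | I 0 ω = k ∧ (R 0 ω).1 = j₂})
    (s₂ := {ω | I 0 ω = k}) (by rintro ω ((hω | hω) | hω) <;> exact hω.1)
  rw [measureReal_union ((hd _ _ hj₂).union_left (hd _ _ hj)) (h.measurableSet_class k j₂),
    measureReal_union (hd _ _ hj₁) (h.measurableSet_class k j₁), h1, h2, h.measure_flow] at hsum
  have hle : requestProb μ I R {k} (j, i) ≤ μ.real {ω | I 0 ω = k ∧ (R 0 ω).1 = j} := by
    refine measureReal_mono ?_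
    rintro ω ⟨hk, hr⟩
    exact ⟨by simpa using hk, by rw [hr]⟩
  have hflow : p₁ * P.flowProb k + p₂ * P.flowProb k = P.flowProb k := by
    rw [← add_mul, hp, one_mul]
  exact le_antisymm (by linarith) (requestProb_nonneg _ _)

theorem tendsto_requestProb_requestCoef (h : IsRequestModel μ I R α P) (hP : P.Pos) (k : Fin 2)
    (j : ItemClass) :
    Tendsto (fun i : ℕ => requestProb μ I R {k} (j, i) * ((i : ℝ) + 1) ^ α) atTop
      (𝓝 (requestCoef P k j)) := by
  have hP' := hP
  obtain ⟨h1, h2, h3, h4, h5, h6, h7, h8, h9⟩ := hP'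
  have hA := h.measure_class hP h.classA
  have hD₁ := h.measure_class hP h.classD₁
  have hB := h.measure_class hP h.classB
  have hD₂ := h.measure_class hP h.classD₂
  have hlim : ∀ {k : Fin 2} {j : ItemClass} {p c : ℝ}, 0 < p →
      μ.real {ω | I 0 ω = k ∧ (R 0 ω).1 = j} = p * P.flowProb k →
      ((fun i : ℕ => (μ[|{ω | I 0 ω = k ∧ (R 0 ω).1 = j}]).real {ω | R 0 ω = (j, i)})
        ~[atTop] fun i : ℕ => c / ((i : ℝ) + 1) ^ α) →
      Tendsto (fun i : ℕ => requestProb μ I R {k} (j, i) * ((i : ℝ) + 1) ^ α) atTop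
        (𝓝 (c * p * P.flowProb k)) := fun {k} _ _ _ hp hc hz => by
    rw [mul_assoc]
    exact h.tendsto_requestProb hc (mul_pos hp (hP.flowProb_pos k)).ne' hz
  have hzero : ∀ {k : Fin 2} {j : ItemClass}, (∀ i, requestProb μ I R {k} (j, i) = 0) →
      Tendsto (fun i : ℕ => requestProb μ I R {k} (j, i) * ((i : ℝ) + 1) ^ α) atTop (𝓝 0) :=
    fun hk => by simp [hk]
  match k, j with
  | 0, .A => exact hlim h6 hA h.zipfA
  | 0, .B => exact hzero (h.requestProb_eq_zero hA hD₁ h.sum₁ (by decide) (by decide) (by decide))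
  | 0, .D => exact hlim h8 hD₁ (h.zipfD 0)
  | 1, .A => exact hzero (h.requestProb_eq_zero hB hD₂ h.sum₂ (by decide) (by decide) (by decide))
  | 1, .B => exact hlim h7 hB h.zipfB
  | 1, .D => exact hlim h9 hD₂ (h.zipfD 1)

theorem tendsto_missProb_requestCoef (h : IsRequestModel μ I R α P) (hα : 1 < α) (hP : P.Pos)
    {K : Finset (Fin 2)} {k : Fin 2} (hk : k ∈ K) :
    Tendsto (fun y => y ^ (α - 1) * missProb μ I R K k y) atTop
      (𝓝 (missConst α * distinctConst α ^ (α - 1) * (shareCoef α (requestCoef P) K k *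
        sizeCoef α (requestCoef P) K ^ (α - 1)))) := by
  have h1 := h.tendsto_missProb hα (h.tendsto_requestProb_requestCoef hP) hk
    ⟨.D, requestCoef_D_pos hP k⟩
  have h2 : missConst α * distinctConst α ^ (α - 1) * (shareCoef α (requestCoef P) K k *
      sizeCoef α (requestCoef P) K ^ (α - 1)) =
      missConst α * shareCoef α (requestCoef P) K k *
        (distinctConst α * sizeCoef α (requestCoef P) K) ^ (α - 1) := by
    rw [Real.mul_rpow (distinctConst_pos hα).le (sizeCoef_nonneg (requestCoef_nonneg hP) K)]
    ring
  rw [h2]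
  exact h1

theorem poolMiss_eq (h : IsRequestModel μ I R α P) (k : Fin 2) (y : ℝ) :
    poolMiss μ I R k y = (P.flowProb k)⁻¹ * missProb μ I R Finset.univ k y := by
  rw [poolMiss, cond_real_eq μ (h.measurableSet_flow k), h.measure_flow, missProb]
  simp only [Finset.mem_univ]
  rfl

theorem sepMiss_eq (h : IsRequestModel μ I R α P) (k : Fin 2) (y : ℝ) :
    sepMiss μ I R k y = (P.flowProb k)⁻¹ * missProb μ I R {k} k y := by
  rw [sepMiss, cond_real_eq μ (h.measurableSet_flow k), h.measure_flow, missProb]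
  simp only [Finset.mem_singleton]
  rfl

theorem overallSepMiss_eq (h : IsRequestModel μ I R α P) (hP : P.Pos) (v : Fin 2 → ℝ) (x : ℝ) :
    overallSepMiss μ I R v x = ∑ k, missProb μ I R {k} k (v k * x) := by
  refine Finset.sum_congr rfl fun k _ => ?_
  rw [h.sepMiss_eq, h.measure_flow, mul_inv_cancel_left₀ (hP.flowProb_pos k).ne']

theorem tendsto_missProb_singleton (h : IsRequestModel μ I R α P) (hα : 1 < α) (hP : P.Pos)
    (k : Fin 2) :
    Tendsto (fun y => y ^ (α - 1) * missProb μ I R {k} k y) atTop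
      (𝓝 (missConst α * distinctConst α ^ (α - 1) * sizeCoef α (requestCoef P) {k} ^ α)) := by
  have h1 := h.tendsto_missProb_requestCoef hα hP (Finset.mem_singleton_self k)
  have hpos := sizeCoef_singleton_pos (α := α) (requestCoef_nonneg hP) (requestCoef_D_pos hP) k
  rw [shareCoef_singleton hα, ← Real.rpow_one_add' hpos.le (by linarith)] at h1
  simpa only [add_sub_cancel] using h1

theorem missProb_anti (K : Finset (Fin 2)) (k : Fin 2) {y z : ℝ} (hyz : y ≤ z) :
    missProb μ I R K k z ≤ missProb μ I R K k y :=
  measureReal_mono fun _ hω => ⟨hω.1, (ENNReal.ofReal_le_ofReal hyz).trans_lt hω.2⟩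

/-- The positive limit of the scaled miss probability makes it positive at some size `y > 0`, and a
smaller cache misses at least as often. -/
theorem missProb_zero_pos (h : IsRequestModel μ I R α P) (hα : 1 < α) (hP : P.Pos) (k : Fin 2) :
    0 < missProb μ I R {k} k 0 := by
  have hpos : 0 < missConst α * distinctConst α ^ (α - 1) *
      sizeCoef α (requestCoef P) {k} ^ α :=
    mul_pos (mul_pos (missConst_pos hα) (Real.rpow_pos_of_pos (distinctConst_pos hα) _))
      (Real.rpow_pos_of_pos
        (sizeCoef_singleton_pos (requestCoef_nonneg hP) (requestCoef_D_pos hP) k) _)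
  obtain ⟨y, hy, hy0⟩ := (((h.tendsto_missProb_singleton hα hP k).eventually_const_lt hpos).and
    (eventually_gt_atTop 0)).exists
  exact (pos_of_mul_pos_right hy (Real.rpow_nonneg hy0.le _)).trans_le (missProb_anti _ _ hy0.le)

/-- The asymptotic gain of pooling over separation. -/
theorem tendsto_poolMiss_div_sepMiss (h : IsRequestModel μ I R α P) (hα : 1 < α) (hP : P.Pos)
    {k : Fin 2} {c : ℝ} (hc : 0 < c) :
    Tendsto (fun x : ℝ => poolMiss μ I R k x / sepMiss μ I R k (c * x)) atTop
      (𝓝 (c ^ (α - 1) * (shareCoef α (requestCoef P) Finset.univ k *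
        sizeCoef α (requestCoef P) Finset.univ ^ (α - 1)) /
          sizeCoef α (requestCoef P) {k} ^ α)) := by
  have hκ : 0 < missConst α * distinctConst α ^ (α - 1) :=
    mul_pos (missConst_pos hα) (Real.rpow_pos_of_pos (distinctConst_pos hα) _)
  have hw : 0 < sizeCoef α (requestCoef P) {k} ^ α := Real.rpow_pos_of_pos
    (sizeCoef_singleton_pos (requestCoef_nonneg hP) (requestCoef_D_pos hP) k) _
  have h1 := h.tendsto_missProb_requestCoef hα hP (Finset.mem_univ k)
  have h2 := (h.tendsto_missProb_singleton hα hP k).comp (tendsto_id.const_mul_atTop hc)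
  have h3 := (h1.div h2 (mul_pos hκ hw).ne').const_mul (c ^ (α - 1))
  -- The constants from the integrals are common to pooling and separation and cancel.
  rw [mul_div_mul_left _ _ hκ.ne', ← mul_div_assoc] at h3
  refine h3.congr' ?_
  filter_upwards [eventually_gt_atTop 0] with x hx
  have hx' := (Real.rpow_pos_of_pos hx (α - 1)).ne'
  have hc' := (Real.rpow_pos_of_pos hc (α - 1)).ne'
  simp only [Pi.div_apply, Function.comp_apply, id]
  rw [h.poolMiss_eq, h.sepMiss_eq, mul_div_mul_left _ _ (inv_pos.2 (hP.flowProb_pos k)).ne',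
    Real.mul_rpow hc.le hx.le, ← mul_div_assoc, mul_assoc (c ^ (α - 1)),
    mul_div_mul_left _ _ hc', mul_div_mul_left _ _ hx']

end IsRequestModel

end Zipf

end LRUCache

end

theorem corollary5 {Ω : Type*} [MeasurableSpace Ω] (μ : Measure Ω) [IsProbabilityMeasure μ]
    (I : ℤ → Ω → Fin 2) (R : ℤ → Ω → LRUCache.DataItem) (α : ℝ) (hα : 1 < α)
    (P : LRUCache.Params) (hP : P.Pos) (h : LRUCache.IsRequestModel μ I R α P) :
    (∀ u : Fin 2 → ℝ, (∀ k, 0 < u k) → P ∈ LRUCache.goodRegion α u →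
      ∀ k : Fin 2, ∃ L : ℝ, L < 1 ∧
        Tendsto (fun x : ℝ => LRUCache.poolMiss μ I R k x / LRUCache.sepMiss μ I R k (u k * x))
          atTop (𝓝 L)) ∧
    (∃ u : Fin 2 → ℝ, LRUCache.IsOptimalSeparation μ I R u) ∧
    (∀ u : Fin 2 → ℝ, LRUCache.IsOptimalSeparation μ I R u →
      (∀ k, 0 < u k) ∧ P ∈ LRUCache.goodRegion α u) := by
  have ha := LRUCache.requestCoef_nonneg hP
  have hD := LRUCache.requestCoef_D_pos hP
  have hw : ∀ k, 0 < LRUCache.sizeCoef α (LRUCache.requestCoef P) {k} :=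
    LRUCache.sizeCoef_singleton_pos ha hD
  have hκ : 0 < LRUCache.missConst α * LRUCache.distinctConst α ^ (α - 1) :=
    mul_pos (LRUCache.missConst_pos hα) (Real.rpow_pos_of_pos (LRUCache.distinctConst_pos hα) _)
  have hG0 : ∀ k y, 0 ≤ LRUCache.missProb μ I R {k} k y := fun _ _ => measureReal_nonneg
  have hGz := h.missProb_zero_pos hα hP
  have hG := h.tendsto_missProb_singleton hα hP
  refine ⟨fun u hu hgood k => ?_, ?_, fun u hu => ?_⟩
  · refine ⟨_, ?_, h.tendsto_poolMiss_div_sepMiss hα hP (hu k)⟩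
    rw [div_lt_one (Real.rpow_pos_of_pos (hw k) α)]
    exact (LRUCache.mem_goodRegion_iff hα hP).1 hgood k
  · refine ⟨_, LRUCache.isSeparation_proportional hw, fun v hv ε hε => ?_⟩
    simp_rw [h.overallSepMiss_eq hP]
    exact LRUCache.eventually_sum_proportional_le hα hκ hw hG0 hGz hG hv hε
  -- Optimality is needed only against the proportional separation, which identifies `u` with it.
  · have hopt := hu.2 _ (LRUCache.isSeparation_proportional hw)
    simp_rw [h.overallSepMiss_eq hP] at hopt
    rw [LRUCache.eq_proportionalSeparation_of_optimal hα hκ hw hG0 hGz hG hu.1 hopt]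
    exact ⟨LRUCache.proportionalSeparation_pos hw, (LRUCache.mem_goodRegion_iff hα hP).2
      (LRUCache.proportional_pool_lt hα ha hD)⟩
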